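/- Let $\mathbb S=\mathbb R/2\pi\mathbb Z$ and consider on $\mathbb R^2\times\mathbb S$ the control system $$\dot x=\cos\theta,\qquad \dot y=\sin\theta,\qquad \dot\theta=u$$ with measurable (integrable) real controls $u$ on $[0,T]$, where $T>0$ is fixed. Let $\mathcal Z_T\subset\mathbb R^2\times\mathbb S$ be the set of initial states that some control steers to $(0,0,-\pi/2)$ in time exactly $T$. For $\boldsymbol z\in\mathcal Z_T$, call a control optimal if it minimizes $\int_0^T\frac12u^2\,dt\in[0,\infty]$ among all controls steering $\boldsymbol z$ to $(0,0,-\pi/2)$ in time $T$, and let the optimal feedback $N(\boldsymbol z)$ be the value at $t=0$ of an optimal control; since controls are determined only almost everywhere, this value is the essential limit of the control at $0$ from the right, and since optimal controls need not be unique, $N(\boldsymbol z)$ denotes any of the values so obtained. For $\boldsymbol q=(p_x,p_y,c_0)\in\mathbb R^3$ let $\boldsymbol Z(t,\boldsymbol q)=(X,Y,\Theta)(t,\boldsymbol q)$ be the solution of $$\dot X=-\cos\Theta,\qquad \dot Y=-\sin\Theta,\qquad \dot\Theta=-(p_xY-p_yX+c_0),\qquad (X,Y,\Theta)(0)=(0,0,-\pi/2),$$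 and set $U(t,\boldsymbol q)=p_xY(t,\boldsymbol q)-p_yX(t,\boldsymbol q)+c_0$. Then for every $\boldsymbol z\in\mathcal Z_T$ an optimal control exists, every optimal control has a value at $t=0$ in the above sense, and for every value $N(\boldsymbol z)$ of the optimal feedback there is a $\boldsymbol q\in\mathbb R^3$ with $\boldsymbol z=\boldsymbol Z(T,\boldsymbol q)$ and $N(\boldsymbol z)=U(T,\boldsymbol q)$. Conversely, $\boldsymbol Z(T,\boldsymbol q)\in\mathcal Z_T$ for every $\boldsymbol q\in\mathbb R^3$. -/

import Mathlib

open MeasureTheory Filter Topology Set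
open scoped ENNReal NNReal

noncomputable section

namespace Guidance

/-- States `(x, y, θ)`: a position in the plane and a heading on the circle `ℝ / 2πℤ`. -/
abbrev State : Type := ℝ × ℝ × Real.Angle

/-- The final state `(0, 0, -π/2)`. -/
def finalState : State := (0, 0, ((-(Real.pi / 2) : ℝ) : Real.Angle))

/-- `(x, y, θ)`, with `θ` a real-valued lift of the heading, is a trajectory of
`x' = cos θ, y' = sin θ, θ' = u` on `[0, T]` under the control `u` (an integrable measurable
function): the three functions are absolutely continuous and solve the system almost everywhere,
which is expressed by the integral equations. -/
structure IsTrajectory (T : ℝ) (u x y θ : ℝ → ℝ) : Prop where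
  integrable : IntervalIntegrable u volume 0 T
  x_eq : ∀ t ∈ Icc 0 T, x t = x 0 + ∫ s in (0 : ℝ)..t, Real.cos (θ s)
  y_eq : ∀ t ∈ Icc 0 T, y t = y 0 + ∫ s in (0 : ℝ)..t, Real.sin (θ s)
  θ_eq : ∀ t ∈ Icc 0 T, θ t = θ 0 + ∫ s in (0 : ℝ)..t, u s

/-- The control `u` steers the system from `z` to the final state `(0, 0, -π/2)` in time `T`. -/
def Steers (T : ℝ) (z : State) (u : ℝ → ℝ) : Prop :=
  ∃ x y θ : ℝ → ℝ, IsTrajectory T u x y θ ∧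
    ((x 0, y 0, (θ 0 : Real.Angle)) : State) = z ∧
    ((x T, y T, (θ T : Real.Angle)) : State) = finalState

/-- The set `𝒵_T` of states that can be steered to the final state in time `T`. -/
def controllableSet (T : ℝ) : Set State := {z | ∃ u, Steers T z u}

/-- The control effort `∫₀ᵀ u² / 2`, which is `∞` if `u` is not square integrable. -/
def effort (T : ℝ) (u : ℝ → ℝ) : ℝ≥0∞ :=
  ∫⁻ t in Icc 0 T, ENNReal.ofReal (u t ^ 2 / 2)

/-- `u` is an optimal control of the minimum-effort problem with initial state `z` and
duration `T`. -/
def IsOptimalControl (T : ℝ) (z : State) (u : ℝ → ℝ) : Prop :=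
  Steers T z u ∧ ∀ v, Steers T z v → effort T u ≤ effort T v

/-- The control `u`, which is determined only up to null sets, has the value `v` at the initial
time: `v` is the essential limit of `u` at `0` from the right. -/
def HasInitialValue (u : ℝ → ℝ) (v : ℝ) : Prop :=
  Tendsto u (𝓝[>] 0 ⊓ ae volume) (𝓝 v)

/-- The optimal feedback at the state `z` with time-to-go `T`: the set of the initial values of
the optimal controls from `z`. (Optimal controls need not be unique, so this is set-valued.) -/
def optimalFeedback (T : ℝ) (z : State) : Set ℝ :=
  {v | ∃ u, IsOptimalControl T z u ∧ HasInitialValue u v}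

/-- The right-hand side of the backward system with parameter `q = (p_x, p_y, c₀)`. -/
def backwardField (q : ℝ × ℝ × ℝ) (w : ℝ × ℝ × ℝ) : ℝ × ℝ × ℝ :=
  (-Real.cos w.2.2, -Real.sin w.2.2, -(q.1 * w.2.1 - q.2.1 * w.1 + q.2.2))

/-- `w = (X, Y, Θ)`, with `Θ` a real-valued lift of the heading, solves the backward system
with parameter `q` and starts at `(0, 0, -π/2)`. -/
def IsBackwardSolution (q : ℝ × ℝ × ℝ) (w : ℝ → ℝ × ℝ × ℝ) : Prop :=
  w 0 = (0, 0, -(Real.pi / 2)) ∧ ∀ t, HasDerivAt w (backwardField q (w t)) t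

/-- Global existence and uniqueness for an autonomous ODE with a `C¹`, globally Lipschitz
right-hand side. -/
theorem existsUnique_global_solution {E : Type*} [NormedAddCommGroup E] [NormedSpace ℝ E]
    [CompleteSpace E] {f : E → E} (hf : ContDiff ℝ 1 f) {K : ℝ≥0} (hK : LipschitzWith K f)
    (x₀ : E) : ∃! γ : ℝ → E, γ 0 = x₀ ∧ ∀ t, HasDerivAt γ (f (γ t)) t := by
  have key : ∃ γ : ℝ → E, γ 0 = x₀ ∧ ∀ t, HasDerivAt γ (f (γ t)) t := by
    have hv : ContMDiff (modelWithCornersSelf ℝ E) (modelWithCornersSelf ℝ E).tangent 1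
        (fun x ↦ (⟨x, f x⟩ : TangentBundle (modelWithCornersSelf ℝ E) E)) :=
      contMDiff_vectorSpace_iff_contDiff.2 hf
    have hε : (0 : ℝ) < 1 / (K + 1) := by positivity
    obtain ⟨γ, h0, h⟩ := exists_isMIntegralCurve_of_isMIntegralCurveOn
      (I := modelWithCornersSelf ℝ E) (M := E) (v := f) hv hε (fun x ↦ by
        have hpl : IsPicardLindelof (fun _ : ℝ ↦ f) (tmin := -(1 / ((K : ℝ) + 1)))
            (tmax := 1 / ((K : ℝ) + 1)) ⟨0, by constructor <;> linarith⟩ x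
            (‖f x‖₊ + 1) 0 ((K + 1) * (‖f x‖₊ + 1)) K := by
          apply IsPicardLindelof.of_time_independent
          · intro y hy
            have h1 := hK.norm_sub_le y x
            have h2 : ‖y - x‖ ≤ ‖f x‖ + 1 := by simpa [dist_eq_norm] using hy
            have h3 : ‖f y‖ ≤ ‖f y - f x‖ + ‖f x‖ := norm_le_norm_sub_add _ _
            have h4 : (K : ℝ) * ‖y - x‖ ≤ K * (‖f x‖ + 1) := by gcongr
            push_cast
            nlinarith
          · exact hK.lipschitzOnWith
          · simp only [sub_zero, zero_sub, neg_neg, max_self]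
            push_cast
            simp only [sub_zero]
            apply le_of_eq
            field_simp
        obtain ⟨α, hα0, hα⟩ := hpl.exists_eq_forall_mem_Icc_hasDerivWithinAt₀
        refine ⟨α, hα0, fun t ht ↦ ?_⟩
        have h1 : HasDerivWithinAt α (f (α t)) (Ioo (-(1 / ((K : ℝ) + 1))) (1 / ((K : ℝ) + 1))) t :=
          (hα t (Ioo_subset_Icc_self ht)).mono Ioo_subset_Icc_self
        exact h1.hasFDerivWithinAt.hasMFDerivWithinAt) x₀
    exact ⟨γ, h0, fun t ↦ hasDerivAt_iff_hasFDerivAt.2 (hasMFDerivAt_iff_hasFDerivAt.1 (h t))⟩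
  obtain ⟨γ, h0, h⟩ := key
  refine ⟨γ, ⟨h0, h⟩, ?_⟩
  rintro η ⟨e0, e⟩
  exact ODE_solution_unique_univ (v := fun _ ↦ f) (s := fun _ ↦ univ) (t₀ := 0)
    (fun _ ↦ hK.lipschitzOnWith) (fun t ↦ ⟨e t, trivial⟩) (fun t ↦ ⟨h t, trivial⟩)
    (e0.trans h0.symm)

theorem existsUnique_isBackwardSolution (q : ℝ × ℝ × ℝ) : ∃! w, IsBackwardSolution q w := by
  have hf : ContDiff ℝ 1 (backwardField q) := by
    unfold backwardField
    fun_prop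
  have hK : LipschitzWith (max 1 (max 1 (‖q.1‖₊ + ‖q.2.1‖₊))) (backwardField q) := by
    have hp : LipschitzWith 1 (fun w : ℝ × ℝ × ℝ ↦ w.2.2) := by
      simpa using! LipschitzWith.prod_snd.comp LipschitzWith.prod_snd
    refine LipschitzWith.prodMk ?_ (LipschitzWith.prodMk ?_ ?_)
    · have h := (Real.lipschitzWith_cos.comp hp).neg
      rw [one_mul] at h
      exact h
    · have h := (Real.lipschitzWith_sin.comp hp).neg
      rw [one_mul] at h
      exact h
    · refine LipschitzWith.of_dist_le_mul fun a b ↦ ?_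
      have h1 : |a.1 - b.1| ≤ ‖a - b‖ := norm_fst_le (a - b)
      have h2 : |a.2.1 - b.2.1| ≤ ‖a - b‖ :=
        (norm_fst_le (a - b).2).trans (norm_snd_le (a - b))
      rw [dist_eq_norm, dist_eq_norm, Real.norm_eq_abs]
      have h3 : -(q.1 * a.2.1 - q.2.1 * a.1 + q.2.2) - -(q.1 * b.2.1 - q.2.1 * b.1 + q.2.2)
          = -(q.1 * (a.2.1 - b.2.1)) + q.2.1 * (a.1 - b.1) := by ring
      rw [h3]
      refine (abs_add_le _ _).trans ?_
      rw [abs_neg, abs_mul, abs_mul]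
      push_cast
      simp only [Real.norm_eq_abs]
      rw [add_mul]
      gcongr
  exact existsUnique_global_solution hf hK _

/-- The real-valued lift `(X, Y, Θ)(t, q)` of the solution of the `q`-parameterized system. -/
def backwardSolution (q : ℝ × ℝ × ℝ) : ℝ → ℝ × ℝ × ℝ :=
  (existsUnique_isBackwardSolution q).choose

theorem backwardSolution_spec (q : ℝ × ℝ × ℝ) : IsBackwardSolution q (backwardSolution q) :=
  (existsUnique_isBackwardSolution q).choose_spec.1

/-- `Z(t, q)`, the state at time `t` of the `q`-parameterized system. -/
def Z (t : ℝ) (q : ℝ × ℝ × ℝ) : State :=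
  ((backwardSolution q t).1, (backwardSolution q t).2.1,
    ((backwardSolution q t).2.2 : Real.Angle))

/-- `U(t, q) = p_x Y(t, q) - p_y X(t, q) + c₀`. -/
def U (t : ℝ) (q : ℝ × ℝ × ℝ) : ℝ :=
  q.1 * (backwardSolution q t).2.1 - q.2.1 * (backwardSolution q t).1 + q.2.2

end Guidance

end

open Guidance

/-! Once a real lift of the initial heading is fixed, the trajectory is determined by the control,
so the problem is to minimize the norm of `u` in L² under finitely many constraints on the primitive
of `u`: its terminal value and the integrals of its cosine and sine.

Existence is the direct method (`exists_isOptimalControl`). Weak convergence of controls gives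
pointwise convergence of headings, so the constraints pass to the limit, and the norm is weakly
lower semicontinuous. A minimizing sequence needs a competitor of finite effort, while
controllability supplies only an integrable control. At a nonconstant heading the endpoint values
and the displacement form a submersion on continuous functions, so the heading can be replaced by a
polynomial with the same data; a constant heading is produced by the zero control
(`exists_steers_effort_lt_top`).

For the form of the optimum, the Lagrange multiplier rule and an integration by parts give `a + b y
- c x + d u = 0` almost everywhere. If `d ≠ 0`, then `u` is affine in the position. If `d = 0`, the
path lies on a line, the heading is constant, and optimality forces `u = 0`, which is affine too
(`IsOptimalControl.exists_ae_eq`). Reversing time turns the trajectory into a solution of the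
backward system, which uniqueness identifies with `Z` (`exists_eq_Z_of_ae_eq`). The converse reads a
backward solution in reverse as a controlled trajectory. -/

noncomputable section

namespace Guidance

/-! ### Differentiability of integral functionals on continuous functions. -/

section IntegralFunctional

variable {K : Type*} [TopologicalSpace K] [CompactSpace K] [MeasurableSpace K] [BorelSpace K]

theorem integrable_continuousMap (μ : Measure K) [IsFiniteMeasure μ]
    (f : C(K, ℝ)) : Integrable (fun x ↦ f x) μ :=
  Integrable.of_bound (C := ‖f‖) f.continuous.measurable.aestronglyMeasurable
    (ae_of_all _ fun x ↦ f.norm_coe_le_norm x)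

/-- The functional `φ ↦ ∫ h φ` on the space of continuous functions. -/
def integralMulCLM (μ : Measure K) [IsFiniteMeasure μ] (h : C(K, ℝ)) : C(K, ℝ) →L[ℝ] ℝ :=
  LinearMap.mkContinuous
    { toFun := fun φ ↦ ∫ x, h x * φ x ∂μ
      map_add' := fun φ ψ ↦ by
        have h1 := integral_add (integrable_continuousMap μ (h * φ))
          (integrable_continuousMap μ (h * ψ))
        simpa [mul_add] using h1
      map_smul' := fun c φ ↦ by
        rw [RingHom.id_apply, smul_eq_mul, ← integral_const_mul]
        simp [mul_left_comm] }
    (‖h‖ * μ.real univ) fun φ ↦ by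
      refine (norm_integral_le_of_norm_le_const (C := ‖h‖ * ‖φ‖) (ae_of_all _ fun x ↦ ?_)).trans
        (le_of_eq (by ring))
      rw [norm_mul]
      gcongr
      · exact h.norm_coe_le_norm x
      · exact φ.norm_coe_le_norm x

/-- A superposition integral functional `θ ↦ ∫ g (θ x)` is strictly differentiable on the space of
continuous functions if `g` has a Lipschitz derivative. -/
theorem hasStrictFDerivAt_integral_comp (μ : Measure K) [IsFiniteMeasure μ] {g : ℝ → ℝ}
    {g' : C(ℝ, ℝ)} (hg : ∀ x, HasDerivAt g (g' x) x) {L : ℝ≥0} (hL : LipschitzWith L g')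
    (θ : C(K, ℝ)) :
    HasStrictFDerivAt (fun φ : C(K, ℝ) ↦ ∫ x, g (φ x) ∂μ) (integralMulCLM μ (g'.comp θ)) θ := by
  have hgc : Continuous g := continuous_iff_continuousAt.2 fun x ↦ (hg x).continuousAt
  have hint : ∀ φ : C(K, ℝ), Integrable (fun x ↦ g (φ x)) μ := fun φ ↦
    integrable_continuousMap μ ((⟨g, hgc⟩ : C(ℝ, ℝ)).comp φ)
  rw [hasStrictFDerivAt_iff_isLittleO, Asymptotics.isLittleO_iff]
  intro c hc
  -- The `+ 1` keeps the denominator positive when `L` or the total mass vanishes.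
  obtain ⟨δ, hδ, hδc⟩ : ∃ δ > 0, L * δ * μ.real univ ≤ c := by
    refine ⟨c / (L * μ.real univ + 1), by positivity, ?_⟩
    rw [mul_right_comm, mul_div_assoc', div_le_iff₀ (by positivity)]
    nlinarith
  filter_upwards [prod_mem_nhds (Metric.closedBall_mem_nhds θ hδ)
    (Metric.closedBall_mem_nhds θ hδ)] with p hp
  have hmem : ∀ φ : C(K, ℝ), φ ∈ Metric.closedBall θ δ → ∀ x, φ x ∈ Metric.closedBall (θ x) δ :=
    fun φ hφ x ↦ (ContinuousMap.dist_apply_le_dist x).trans hφ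
  have hpt : ∀ x, ‖g (p.1 x) - g (p.2 x) - g' (θ x) * (p.1 x - p.2 x)‖ ≤ L * δ * ‖p.1 - p.2‖ := by
    intro x
    -- Mean value inequality for `g` minus its linear part at `θ x`, whose derivative is at most `L
    -- * δ` on the ball.
    have h1 := (convex_closedBall (θ x) δ).norm_image_sub_le_of_norm_hasDerivWithin_le
      (f := fun y ↦ g y - g' (θ x) * y) (f' := fun y ↦ g' y - g' (θ x)) (C := L * δ)
      (fun y _ ↦ by
        have h := ((hg y).sub ((hasDerivAt_id y).const_mul (g' (θ x)))).hasDerivWithinAt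
          (s := Metric.closedBall (θ x) δ)
        rw [mul_one] at h
        exact h)
      (fun y hy ↦ by
        rw [← dist_eq_norm]
        exact (hL.dist_le_mul y (θ x)).trans (by gcongr; exact hy))
      (hmem p.2 hp.2 x) (hmem p.1 hp.1 x)
    have h2 : ‖p.1 x - p.2 x‖ ≤ ‖p.1 - p.2‖ := (p.1 - p.2).norm_coe_le_norm x
    calc _ = ‖g (p.1 x) - g' (θ x) * p.1 x - (g (p.2 x) - g' (θ x) * p.2 x)‖ := by
          congr 1; ring
      _ ≤ L * δ * ‖p.1 x - p.2 x‖ := h1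
      _ ≤ _ := by gcongr
  have heq : (∫ x, g (p.1 x) ∂μ) - (∫ x, g (p.2 x) ∂μ) - integralMulCLM μ (g'.comp θ) (p.1 - p.2)
      = ∫ x, (g (p.1 x) - g (p.2 x) - g' (θ x) * (p.1 x - p.2 x)) ∂μ := by
    have h1 := integral_sub ((hint p.1).sub (hint p.2))
      (integrable_continuousMap μ (g'.comp θ * (p.1 - p.2)))
    have h2 := integral_sub (hint p.1) (hint p.2)
    rw [← h2]
    exact h1.symm
  rw [heq]
  calc _ ≤ L * δ * ‖p.1 - p.2‖ * μ.real univ :=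
        norm_integral_le_of_norm_le_const (ae_of_all _ hpt)
    _ = L * δ * μ.real univ * ‖p.1 - p.2‖ := by ring
    _ ≤ _ := by gcongr

end IntegralFunctional

/-! ### Level sets of submersions and dense subspaces. -/

section Dense

variable {E F : Type*} [NormedAddCommGroup E] [NormedSpace ℝ E]
  [NormedAddCommGroup F] [NormedSpace ℝ F] [FiniteDimensional ℝ F]

/-- The image of `D` is a dense subspace of a finite-dimensional space, hence closed and everything.
So `D` already contains a preimage of each vector, chosen linearly. -/
theorem exists_rightInverse_range_le_of_dense {A : E →L[ℝ] F} (hA : A.range = ⊤)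
    {D : Submodule ℝ E} (hD : Dense (D : Set E)) :
    ∃ R : F →L[ℝ] E, (∀ y, R y ∈ D) ∧ ∀ y, A (R y) = y := by
  have hsurj : Function.Surjective A := LinearMap.range_eq_top.1 hA
  have hmap : D.map (A : E →ₗ[ℝ] F) = ⊤ := by
    have h1 : Dense ((D.map (A : E →ₗ[ℝ] F) : Submodule ℝ F) : Set F) := by
      rw [Submodule.map_coe]
      exact hsurj.denseRange.dense_image A.continuous hD
    have h2 : IsClosed ((D.map (A : E →ₗ[ℝ] F) : Submodule ℝ F) : Set F) :=
      Submodule.closed_of_finiteDimensional _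
    rw [← SetLike.coe_set_eq, ← h2.closure_eq, h1.closure_eq]
    rfl
  have hsurj' : Function.Surjective ((A : E →ₗ[ℝ] F).domRestrict D) := by
    intro y
    have hy : y ∈ D.map (A : E →ₗ[ℝ] F) := hmap ▸ Submodule.mem_top
    obtain ⟨x, hx, rfl⟩ := hy
    exact ⟨⟨x, hx⟩, rfl⟩
  obtain ⟨r, hr⟩ := ((A : E →ₗ[ℝ] F).domRestrict D).exists_rightInverse_of_surjective
    (LinearMap.range_eq_top.2 hsurj')
  refine ⟨LinearMap.toContinuousLinearMap (D.subtype ∘ₗ r), fun y ↦ (r y).2, fun y ↦ ?_⟩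
  exact LinearMap.congr_fun hr y

/-- If a map to a finite-dimensional space is a strict submersion at `x`, then its level set
through `x` meets every dense subspace. -/
theorem exists_mem_eq_of_hasStrictFDerivAt_of_dense [CompleteSpace E] {f : E → F}
    {A : E →L[ℝ] F} {x : E}
    (hf : HasStrictFDerivAt f A x) (hA : A.range = ⊤) {D : Submodule ℝ E}
    (hD : Dense (D : Set E)) : ∃ w ∈ D, f w = f x := by
  obtain ⟨R, hRD, hR⟩ := exists_rightInverse_range_le_of_dense hA hD
  -- `Ψ` straightens `f`: it satisfies `A ∘ Ψ = f`, has derivative the identity at `x`, and moves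
  -- points only along `D`.
  set Ψ : E → E := fun w ↦ w + R (f w - A w) with hΨ
  have hstrict : HasStrictFDerivAt Ψ (ContinuousLinearEquiv.refl ℝ E : E →L[ℝ] E) x := by
    have h := (hasStrictFDerivAt_id x).add
      (R.hasStrictFDerivAt.comp x (hf.sub A.hasStrictFDerivAt))
    rw [sub_self, ContinuousLinearMap.comp_zero, add_zero] at h
    exact h
  have hAΨ : ∀ w, A (Ψ w) = f w := fun w ↦ by simp [hΨ, hR]
  obtain ⟨d, hd, hlim⟩ := mem_closure_iff_seq_limit.1 (hD.closure_eq ▸ mem_univ (Ψ x))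
  -- The correction by `R` puts the approximants on the fibre of `A` over `f x` without leaving `D`.
  -- As `Ψ` is open at `x`, one of them is a value `Ψ w`.
  have hy : Tendsto (fun n ↦ d n - R (A (d n) - f x)) atTop (𝓝 (Ψ x)) := by
    have hcont : Continuous fun e : E ↦ e - R (A e - f x) := by fun_prop
    have h := hcont.tendsto (Ψ x)
    rw [hAΨ, sub_self, map_zero, sub_zero] at h
    exact h.comp hlim
  rw [← hstrict.map_nhds_eq_of_equiv] at hy
  have himg : ∀ᶠ y in map Ψ (𝓝 x), y ∈ range Ψ := by
    rw [eventually_map]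
    exact Eventually.of_forall fun w ↦ mem_range_self w
  obtain ⟨n, w, hw⟩ := (hy.eventually himg).exists
  have hfw : f w = f x := by rw [← hAΨ w, hw]; simp [hR]
  refine ⟨w, ?_, hfw⟩
  have : w = d n - R (A (d n) - f x) - R (f w - A w) := by rw [← hw]; simp [hΨ]
  rw [this]
  exact D.sub_mem (D.sub_mem (hd n) (hRD _)) (hRD _)

end Dense

/-! ### Steering as a condition on the control alone. -/

/-- Any lift of the initial heading serves, since cosine and sine factor through the circle; the
trajectory is thereby eliminated. -/
theorem steers_iff {T : ℝ} (hT : 0 < T) {z : State} {θ₀ : ℝ} (hθ₀ : (θ₀ : Real.Angle) = z.2.2)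
    {u : ℝ → ℝ} :
    Steers T z u ↔ IntervalIntegrable u volume 0 T ∧
      z.1 + ∫ t in (0 : ℝ)..T, Real.cos (θ₀ + ∫ s in (0 : ℝ)..t, u s) = 0 ∧
      z.2.1 + ∫ t in (0 : ℝ)..T, Real.sin (θ₀ + ∫ s in (0 : ℝ)..t, u s) = 0 ∧
      ((θ₀ + ∫ s in (0 : ℝ)..T, u s : ℝ) : Real.Angle) = ((-(Real.pi / 2) : ℝ) : Real.Angle) := by
  constructor
  · rintro ⟨x, y, θ, h, h0, h1⟩
    simp only [Prod.ext_iff, finalState] at h0 h1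
    have hθ : ∀ t ∈ Icc 0 T, (θ t : Real.Angle) =
        ((θ₀ + ∫ s in (0 : ℝ)..t, u s : ℝ) : Real.Angle) := by
      intro t ht
      rw [h.θ_eq t ht, Real.Angle.coe_add, Real.Angle.coe_add, h0.2.2, hθ₀]
    have hTm : T ∈ Icc 0 T := ⟨hT.le, le_rfl⟩
    refine ⟨h.integrable, ?_, ?_, ?_⟩
    · have hi : ∫ t in (0 : ℝ)..T, Real.cos (θ₀ + ∫ s in (0 : ℝ)..t, u s)
          = ∫ t in (0 : ℝ)..T, Real.cos (θ t) := by
        refine intervalIntegral.integral_congr fun t ht ↦ ?_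
        rw [uIcc_of_le hT.le] at ht
        rw [← Real.Angle.cos_coe, ← Real.Angle.cos_coe (θ t), hθ t ht]
      rw [hi, ← h0.1, ← h.x_eq T hTm, h1.1]
    · have hi : ∫ t in (0 : ℝ)..T, Real.sin (θ₀ + ∫ s in (0 : ℝ)..t, u s)
          = ∫ t in (0 : ℝ)..T, Real.sin (θ t) := by
        refine intervalIntegral.integral_congr fun t ht ↦ ?_
        rw [uIcc_of_le hT.le] at ht
        rw [← Real.Angle.sin_coe, ← Real.Angle.sin_coe (θ t), hθ t ht]
      rw [hi, ← h0.2.1, ← h.y_eq T hTm, h1.2.1]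
    · rw [← hθ T hTm, h1.2.2]
  · rintro ⟨hu, hx, hy, hθ⟩
    refine ⟨fun t ↦ z.1 + ∫ r in (0 : ℝ)..t, Real.cos (θ₀ + ∫ s in (0 : ℝ)..r, u s),
      fun t ↦ z.2.1 + ∫ r in (0 : ℝ)..t, Real.sin (θ₀ + ∫ s in (0 : ℝ)..r, u s),
      fun t ↦ θ₀ + ∫ s in (0 : ℝ)..t, u s, ⟨hu, ?_, ?_, ?_⟩, ?_, ?_⟩
    · intro t _; simp
    · intro t _; simp
    · intro t _; simp
    · simp [hθ₀]
    · exact Prod.ext hx (Prod.ext hy hθ)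

theorem exists_lift_eq (a : Real.Angle) : ∃ θ : ℝ, (θ : Real.Angle) = a :=
  QuotientAddGroup.mk_surjective a

theorem continuousOn_heading {T : ℝ} (hT : 0 < T) {u : ℝ → ℝ}
    (hu : IntervalIntegrable u volume 0 T) (θ₀ : ℝ) :
    ContinuousOn (fun t ↦ θ₀ + ∫ s in (0 : ℝ)..t, u s) (Icc 0 T) := by
  have h := intervalIntegral.continuousOn_primitive_interval' hu left_mem_uIcc
  rw [uIcc_of_le hT.le] at h
  exact continuousOn_const.add h

/-- Lebesgue measure on `[0, T]`. -/
def volIcc (T : ℝ) : Measure (Icc 0 T) := Measure.comap (↑) (volume : Measure ℝ)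

instance (T : ℝ) : IsFiniteMeasure (volIcc T) := ⟨by
  rw [volIcc, (MeasurableEmbedding.subtype_coe measurableSet_Icc).comap_apply, image_univ,
    Subtype.range_coe]
  exact isCompact_Icc.measure_lt_top⟩

theorem integral_Icc_coe {T : ℝ} (hT : 0 ≤ T) (f : ℝ → ℝ) :
    ∫ t, f t ∂volIcc T = ∫ t in (0 : ℝ)..T, f t := by
  rw [intervalIntegral.integral_of_le hT, ← integral_Icc_eq_integral_Ioc]
  exact integral_subtype_comap measurableSet_Icc f

/-! ### Variational tools: derivatives of the displacement, test functions, integration by parts. -/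

/-- The derivative `-sin` of the cosine as a continuous map. -/
def negSin : C(ℝ, ℝ) := ⟨fun x ↦ -Real.sin x, by fun_prop⟩

/-- The derivative `cos` of the sine as a continuous map. -/
def cosMap : C(ℝ, ℝ) := ⟨Real.cos, Real.continuous_cos⟩

theorem hasStrictFDerivAt_integral_cos {T : ℝ} (θ : C(Icc 0 T, ℝ)) :
    HasStrictFDerivAt (fun φ : C(Icc 0 T, ℝ) ↦ ∫ t, Real.cos (φ t) ∂volIcc T)
      (integralMulCLM (volIcc T) (negSin.comp θ)) θ :=
  hasStrictFDerivAt_integral_comp (volIcc T) (g' := negSin) Real.hasDerivAt_cos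
    (L := 1) Real.lipschitzWith_sin.neg θ

theorem hasStrictFDerivAt_integral_sin {T : ℝ} (θ : C(Icc 0 T, ℝ)) :
    HasStrictFDerivAt (fun φ : C(Icc 0 T, ℝ) ↦ ∫ t, Real.sin (φ t) ∂volIcc T)
      (integralMulCLM (volIcc T) (cosMap.comp θ)) θ :=
  hasStrictFDerivAt_integral_comp (volIcc T) (g' := cosMap) Real.hasDerivAt_sin
    (L := 1) Real.lipschitzWith_cos θ

/-- A continuous heading whose direction is orthogonal to a fixed nonzero vector is constant. -/
theorem eq_of_forall_sin_add_cos_eq_zero {T : ℝ} (hT : 0 < T) {θ : ℝ → ℝ}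
    (hθ : ContinuousOn θ (Icc 0 T)) {c d : ℝ} (hcd : c ≠ 0 ∨ d ≠ 0)
    (h : ∀ t ∈ Icc 0 T, c * Real.sin (θ t) + d * Real.cos (θ t) = 0) :
    ∀ t ∈ Icc 0 T, θ t = θ 0 := by
  have h0 : (0 : ℝ) ∈ Icc 0 T := ⟨le_rfl, hT.le⟩
  have hsin : ∀ t ∈ Icc 0 T, Real.sin (θ t - θ 0) = 0 := by
    intro t ht
    have h1 := h t ht
    have h2 := h 0 h0
    rw [Real.sin_sub]
    rcases hcd with hc | hd
    · apply mul_left_cancel₀ hc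
      linear_combination Real.cos (θ 0) * h1 - Real.cos (θ t) * h2
    · apply mul_left_cancel₀ hd
      linear_combination Real.sin (θ t) * h2 - Real.sin (θ 0) * h1
  intro t ht
  by_contra hne
  have hpos : 0 < |θ t - θ 0| := abs_pos.2 (sub_ne_zero.2 hne)
  have hcont : ContinuousOn (fun s ↦ |θ s - θ 0|) (Icc 0 t) :=
    ((hθ.mono (Icc_subset_Icc_right ht.2)).sub continuousOn_const).abs
  -- By the intermediate value theorem the deviation takes this value, which lies strictly between
  -- `0` and `π`, where the sine cannot vanish.
  have hm : min |θ t - θ 0| 1 ∈ Icc |θ 0 - θ 0| |θ t - θ 0| := by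
    simp
  obtain ⟨s, hs, hsm⟩ := intermediate_value_Icc ht.1 hcont hm
  have h3 := hsin s ⟨hs.1, hs.2.trans ht.2⟩
  have h4 : Real.sin |θ s - θ 0| = 0 := by
    rcases abs_choice (θ s - θ 0) with h | h <;> rw [h]
    · exact h3
    · rw [Real.sin_neg, h3, neg_zero]
  simp only at hsm
  rw [hsm] at h4
  have h5 : 0 < min |θ t - θ 0| 1 := lt_min hpos one_pos
  have h6 : min |θ t - θ 0| 1 < Real.pi :=
    (min_le_right _ _).trans_lt (by linarith [Real.pi_gt_three])
  exact (Real.sin_pos_of_pos_of_lt_pi h5 h6).ne' h4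

/-- A continuous function on `[0, T]` that is orthogonal to all continuous functions vanishing at
the endpoints is zero. -/
theorem eq_zero_of_forall_integral_mul_eq_zero {T : ℝ} (hT : 0 < T) {g : ℝ → ℝ}
    (hg : ContinuousOn g (Icc 0 T))
    (h : ∀ φ : ℝ → ℝ, ContinuousOn φ (Icc 0 T) → φ 0 = 0 → φ T = 0 →
      ∫ t in (0 : ℝ)..T, g t * φ t = 0) :
    ∀ t ∈ Icc 0 T, g t = 0 := by
  have hw : ContinuousOn (fun t : ℝ ↦ t * (T - t)) (Icc 0 T) := by fun_prop
  -- The test function is `g` times a weight that is positive inside and zero at both ends.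
  have h1 := h (fun t ↦ g t * (t * (T - t))) (hg.mul hw) (by simp) (by simp)
  have hc : ContinuousOn (fun t ↦ g t * (g t * (t * (T - t)))) (Icc 0 T) := hg.mul (hg.mul hw)
  have hnn : ∀ t ∈ Icc 0 T, 0 ≤ g t * (g t * (t * (T - t))) := by
    intro t ht
    have := mul_nonneg ht.1 (sub_nonneg.2 ht.2)
    nlinarith [mul_nonneg (sq_nonneg (g t)) this]
  rw [intervalIntegral.integral_of_le hT.le, ← integral_Icc_eq_integral_Ioc,
    integral_eq_zero_iff_of_nonneg_ae (ae_restrict_of_forall_mem measurableSet_Icc hnn)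
      (hc.integrableOn_compact isCompact_Icc)] at h1
  have h2 := Measure.eqOn_Icc_of_ae_eq volume hT.ne h1 hc continuousOn_const
  have h3 : ∀ t ∈ Ioo 0 T, g t = 0 := by
    intro t ht
    have h4 := h2 (Ioo_subset_Icc_self ht)
    have h5 : t * (T - t) ≠ 0 := (mul_pos ht.1 (sub_pos.2 ht.2)).ne'
    simpa [h5, ht.1.ne', (sub_pos.2 ht.2).ne'] using h4
  refine Measure.eqOn_Icc_of_ae_eq volume hT.ne ?_ hg continuousOn_const
  rw [← restrict_Ioo_eq_restrict_Icc]
  exact ae_restrict_of_forall_mem measurableSet_Ioo h3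

/-- Integration by parts for primitives of integrable functions. -/
theorem integral_mul_primitive {T : ℝ} {a v : ℝ → ℝ}
    (ha : IntervalIntegrable a volume 0 T) (hv : IntervalIntegrable v volume 0 T) :
    ∫ t in (0 : ℝ)..T, a t * ∫ s in (0 : ℝ)..t, v s =
      ∫ t in (0 : ℝ)..T, ((∫ s in (0 : ℝ)..T, a s) - ∫ s in (0 : ℝ)..t, a s) * v t := by
  have hA := ha.absolutelyContinuousOnInterval_intervalIntegral (c := 0) left_mem_uIcc
  have hV := hv.absolutelyContinuousOnInterval_intervalIntegral (c := 0) left_mem_uIcc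
  have key := hA.integral_mul_deriv_eq_deriv_mul hV
  have e1 : ∫ t in (0 : ℝ)..T, (∫ s in (0 : ℝ)..t, a s) * deriv (fun t ↦ ∫ s in (0 : ℝ)..t, v s) t
      = ∫ t in (0 : ℝ)..T, (∫ s in (0 : ℝ)..t, a s) * v t := by
    refine intervalIntegral.integral_congr_ae ?_
    filter_upwards [hv.ae_hasDerivAt_integral] with t ht htm
    rw [(ht (uIoc_subset_uIcc htm) 0 left_mem_uIcc).deriv]
  have e2 : ∫ t in (0 : ℝ)..T, deriv (fun t ↦ ∫ s in (0 : ℝ)..t, a s) t * (∫ s in (0 : ℝ)..t, v s)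
      = ∫ t in (0 : ℝ)..T, a t * (∫ s in (0 : ℝ)..t, v s) := by
    refine intervalIntegral.integral_congr_ae ?_
    filter_upwards [ha.ae_hasDerivAt_integral] with t ht htm
    rw [(ht (uIoc_subset_uIcc htm) 0 left_mem_uIcc).deriv]
  rw [e1, e2] at key
  have e3 : ∫ t in (0 : ℝ)..T, ((∫ s in (0 : ℝ)..T, a s) - ∫ s in (0 : ℝ)..t, a s) * v t
      = (∫ s in (0 : ℝ)..T, a s) * (∫ t in (0 : ℝ)..T, v t)
        - ∫ t in (0 : ℝ)..T, (∫ s in (0 : ℝ)..t, a s) * v t := by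
    rw [← intervalIntegral.integral_const_mul, ← intervalIntegral.integral_sub]
    · simp only [sub_mul]
    · exact hv.const_mul _
    · exact hv.continuousOn_mul hA.continuousOn
  rw [e3, key]
  simp

/-! ### From integrable controls to finite effort. -/

/-- The endpoint values of a heading together with the displacement it generates. -/
def boundaryData {T : ℝ} (hT : 0 ≤ T) (φ : C(Icc 0 T, ℝ)) : ℝ × ℝ × ℝ × ℝ :=
  (φ ⟨0, left_mem_Icc.2 hT⟩, φ ⟨T, right_mem_Icc.2 hT⟩, ∫ t, Real.cos (φ t) ∂volIcc T,
    ∫ t, Real.sin (φ t) ∂volIcc T)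

/-- The derivative of `boundaryData` at `θ`. -/
def boundaryDataDeriv {T : ℝ} (hT : 0 ≤ T) (θ : C(Icc 0 T, ℝ)) :
    C(Icc 0 T, ℝ) →L[ℝ] ℝ × ℝ × ℝ × ℝ :=
  (ContinuousMap.evalCLM ℝ ⟨0, left_mem_Icc.2 hT⟩).prod
    ((ContinuousMap.evalCLM ℝ ⟨T, right_mem_Icc.2 hT⟩).prod
      ((integralMulCLM (volIcc T) (negSin.comp θ)).prod
        (integralMulCLM (volIcc T) (cosMap.comp θ))))

theorem hasStrictFDerivAt_boundaryData {T : ℝ} (hT : 0 ≤ T) (θ : C(Icc 0 T, ℝ)) :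
    HasStrictFDerivAt (boundaryData hT) (boundaryDataDeriv hT θ) θ :=
  (ContinuousMap.evalCLM ℝ _).hasStrictFDerivAt.prodMk
    ((ContinuousMap.evalCLM ℝ _).hasStrictFDerivAt.prodMk
      ((hasStrictFDerivAt_integral_cos θ).prodMk (hasStrictFDerivAt_integral_sin θ)))

theorem dense_polynomialFunctions (a b : ℝ) :
    Dense ((polynomialFunctions (Icc a b)).toSubmodule : Set C(Icc a b, ℝ)) := by
  have h := polynomialFunctions_closure_eq_top a b
  rw [← SetLike.coe_set_eq, Subalgebra.topologicalClosure_coe] at h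
  exact dense_iff_closure_eq.2 h

/-- A heading at which `boundaryData` is not a submersion is constant. -/
theorem eq_of_range_boundaryDataDeriv_ne_top {T : ℝ} (hT : 0 < T) {θ : ℝ → ℝ}
    (hθ : ContinuousOn θ (Icc 0 T))
    (h : (boundaryDataDeriv hT.le ⟨(Icc 0 T).domRestrict θ, hθ.domRestrict⟩).range ≠ ⊤) :
    ∀ t ∈ Icc 0 T, θ t = θ 0 := by
  -- A proper range is killed by a nonzero functional; its coordinates act as multipliers.
  obtain ⟨Λ, hΛ, hker⟩ := Submodule.exists_le_ker_of_lt_top _ (lt_top_iff_ne_top.2 h)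
  set a := Λ (1, 0, 0, 0)
  set b := Λ (0, 1, 0, 0)
  set c := Λ (0, 0, 1, 0)
  set d := Λ (0, 0, 0, 1)
  have hrep : ∀ x y z w : ℝ, Λ (x, y, z, w) = x * a + y * b + z * c + w * d := by
    intro x y z w
    have : (x, y, z, w) = x • ((1, 0, 0, 0) : ℝ × ℝ × ℝ × ℝ) + y • (0, 1, 0, 0)
        + z • (0, 0, 1, 0) + w • (0, 0, 0, 1) := by simp
    rw [this, map_add, map_add, map_add, map_smul, map_smul, map_smul, map_smul]
    simp only [smul_eq_mul, a, b, c, d]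
  have hs : ContinuousOn (fun t ↦ -Real.sin (θ t)) (Icc 0 T) :=
    (Real.continuous_sin.comp_continuousOn hθ).neg
  have hc : ContinuousOn (fun t ↦ Real.cos (θ t)) (Icc 0 T) :=
    Real.continuous_cos.comp_continuousOn hθ
  have key : ∀ φ : ℝ → ℝ, ContinuousOn φ (Icc 0 T) → φ 0 * a + φ T * b +
      (∫ t in (0 : ℝ)..T, -Real.sin (θ t) * φ t) * c +
      (∫ t in (0 : ℝ)..T, Real.cos (θ t) * φ t) * d = 0 := by
    intro φ hφ
    rw [← integral_Icc_coe hT.le, ← integral_Icc_coe hT.le, ← hrep]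
    exact LinearMap.mem_ker.1 (hker ⟨⟨(Icc 0 T).domRestrict φ, hφ.domRestrict⟩, rfl⟩)
  have hi : ∀ f φ : ℝ → ℝ, ContinuousOn f (Icc 0 T) → ContinuousOn φ (Icc 0 T) →
      IntervalIntegrable (fun t ↦ f t * φ t) volume 0 T := fun f φ hf hφ ↦
    ContinuousOn.intervalIntegrable_of_Icc hT.le (hf.mul hφ)
  -- Variations vanishing at both ends do not see `a` and `b`, so the velocity is orthogonal to a
  -- fixed vector.
  have hzero := eq_zero_of_forall_integral_mul_eq_zero hT
    (g := fun t ↦ (-c) * Real.sin (θ t) + d * Real.cos (θ t))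
    ((continuousOn_const.mul (Real.continuous_sin.comp_continuousOn hθ)).add
      (continuousOn_const.mul hc)) fun φ hφ h0 h1 ↦ by
      have hk := key φ hφ
      rw [h0, h1, ← intervalIntegral.integral_mul_const, ← intervalIntegral.integral_mul_const,
        zero_mul, zero_mul, add_zero, zero_add,
        ← intervalIntegral.integral_add ((hi _ _ hs hφ).mul_const _)
          ((hi _ _ hc hφ).mul_const _)] at hk
      refine Eq.trans ?_ hk
      refine intervalIntegral.integral_congr fun t _ ↦ ?_
      ring
  by_cases hcd : -c ≠ 0 ∨ d ≠ 0
  · exact eq_of_forall_sin_add_cos_eq_zero hT hθ hcd hzero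
  · push Not at hcd
    exfalso
    have hc0 : c = 0 := neg_eq_zero.1 hcd.1
    -- With `c = d = 0`, one variation for each endpoint forces `a = b = 0`.
    have ha := key (fun t ↦ T - t) (by fun_prop)
    have hb := key (fun t ↦ t) (by fun_prop)
    simp only [hc0, hcd.2, mul_zero, add_zero, sub_zero, sub_self, zero_mul, zero_add,
      mul_eq_zero, hT.ne', false_or] at ha hb
    refine hΛ (LinearMap.ext fun p ↦ ?_)
    obtain ⟨x, y, z, w⟩ := p
    rw [hrep, ha, hb, hc0, hcd.2]
    simp

theorem effort_lt_top_of_continuous {T : ℝ} {u : ℝ → ℝ} (hu : Continuous u) :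
    effort T u < ∞ := by
  have h : IntegrableOn (fun t ↦ u t ^ 2 / 2) (Icc 0 T) :=
    (by fun_prop : Continuous fun t ↦ u t ^ 2 / 2).continuousOn.integrableOn_compact isCompact_Icc
  exact Integrable.lintegral_lt_top h

/-- Handles straight paths, the degenerate case both for finite effort and for the multiplier rule.
-/
theorem Steers.zero_of_heading_const {T : ℝ} (hT : 0 < T) {z : State} {u : ℝ → ℝ}
    (hu : Steers T z u) {θ₀ : ℝ} (hθ₀ : (θ₀ : Real.Angle) = z.2.2)
    (h : ∀ t ∈ Icc 0 T, θ₀ + ∫ s in (0 : ℝ)..t, u s = θ₀) : Steers T z fun _ ↦ 0 := by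
  obtain ⟨-, hx, hy, hend⟩ := (steers_iff hT hθ₀).1 hu
  rw [steers_iff hT hθ₀]
  simp only [intervalIntegral.integral_zero, add_zero]
  have hcongr : ∀ f : ℝ → ℝ, ∫ t in (0 : ℝ)..T, f (θ₀ + ∫ s in (0 : ℝ)..t, u s)
      = ∫ t in (0 : ℝ)..T, f θ₀ := by
    intro f
    refine intervalIntegral.integral_congr fun t ht ↦ ?_
    rw [uIcc_of_le hT.le] at ht
    simp only [h t ht]
  rw [hcongr Real.cos] at hx
  rw [hcongr Real.sin] at hy
  rw [h T ⟨hT.le, le_rfl⟩] at hend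
  exact ⟨intervalIntegrable_const, hx, hy, hend⟩

/-- A state that is controllable by an integrable control is controllable with finite effort. -/
theorem exists_steers_effort_lt_top {T : ℝ} (hT : 0 < T) {z : State}
    (hz : z ∈ controllableSet T) : ∃ u, Steers T z u ∧ effort T u < ∞ := by
  obtain ⟨u, hu'⟩ := hz
  obtain ⟨θ₀, hθ₀⟩ := exists_lift_eq z.2.2
  obtain ⟨hint, hx, hy, hend⟩ := (steers_iff hT hθ₀).1 hu'
  set θ : ℝ → ℝ := fun t ↦ θ₀ + ∫ s in (0 : ℝ)..t, u s with hθdef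
  have hθ : ContinuousOn θ (Icc 0 T) := continuousOn_heading hT hint θ₀
  have hθ0 : θ 0 = θ₀ := by simp [hθdef]
  by_cases hr : (boundaryDataDeriv hT.le ⟨(Icc 0 T).domRestrict θ, hθ.domRestrict⟩).range = ⊤
  -- The new heading is a polynomial `p` with the same endpoints and displacement; the control is
  -- its derivative.
  · obtain ⟨w, ⟨p, -, rfl⟩, hw⟩ := exists_mem_eq_of_hasStrictFDerivAt_of_dense
      (hasStrictFDerivAt_boundaryData hT.le _) hr (dense_polynomialFunctions 0 T)
    simp only [boundaryData, Prod.mk.injEq] at hw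
    obtain ⟨h1, h2, h3, h4⟩ := hw
    have h1' : p.eval 0 = θ₀ := hθ0 ▸ h1
    have h2' : p.eval T = θ T := h2
    have h3' : ∫ t in (0 : ℝ)..T, Real.cos (p.eval t) = ∫ t in (0 : ℝ)..T, Real.cos (θ t) := by
      rw [← integral_Icc_coe hT.le, ← integral_Icc_coe hT.le]
      exact h3
    have h4' : ∫ t in (0 : ℝ)..T, Real.sin (p.eval t) = ∫ t in (0 : ℝ)..T, Real.sin (θ t) := by
      rw [← integral_Icc_coe hT.le, ← integral_Icc_coe hT.le]
      exact h4
    have hp : ∀ t, θ₀ + ∫ s in (0 : ℝ)..t, p.derivative.eval s = p.eval t := by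
      intro t
      rw [intervalIntegral.integral_eq_sub_of_hasDerivAt (fun s _ ↦ p.hasDerivAt s)
        (p.derivative.continuous.intervalIntegrable _ _), h1']
      ring
    refine ⟨fun s ↦ p.derivative.eval s, ?_, effort_lt_top_of_continuous p.derivative.continuous⟩
    rw [steers_iff hT hθ₀]
    simp only [hp]
    refine ⟨p.derivative.continuous.intervalIntegrable _ _, ?_, ?_, ?_⟩
    · rw [h3']; exact hx
    · rw [h4']; exact hy
    · rw [h2']; exact hend
  · have hconst := eq_of_range_boundaryDataDeriv_ne_top hT hθ hr
    refine ⟨fun _ ↦ 0, ?_, effort_lt_top_of_continuous continuous_const⟩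
    exact hu'.zero_of_heading_const hT hθ₀ fun t ht ↦ (hconst t ht).trans hθ0

/-! ### Existence of optimal controls in L². -/

theorem Steers.intervalIntegrable {T : ℝ} {z : State} {u : ℝ → ℝ} (h : Steers T z u) :
    IntervalIntegrable u volume 0 T := by
  obtain ⟨_, _, _, h, -⟩ := h
  exact h.integrable

theorem effort_congr {T : ℝ} {u v : ℝ → ℝ} (h : u =ᵐ[volume.restrict (Ioc 0 T)] v) :
    effort T u = effort T v := by
  rw [Measure.restrict_congr_set Ioc_ae_eq_Icc] at h
  refine lintegral_congr_ae ?_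
  filter_upwards [h] with t ht
  rw [ht]

theorem integral_congr_of_ae_eq {T : ℝ} {u v : ℝ → ℝ}
    (h : u =ᵐ[volume.restrict (Ioc 0 T)] v) {t : ℝ} (ht : t ∈ Icc 0 T) :
    ∫ s in (0 : ℝ)..t, u s = ∫ s in (0 : ℝ)..t, v s := by
  rw [intervalIntegral.integral_of_le ht.1, intervalIntegral.integral_of_le ht.1]
  exact integral_congr_ae (ae_restrict_of_ae_restrict_of_subset (Ioc_subset_Ioc_right ht.2) h)

theorem Steers.congr {T : ℝ} (hT : 0 < T) {z : State} {u v : ℝ → ℝ} (hu : Steers T z u)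
    (h : u =ᵐ[volume.restrict (Ioc 0 T)] v) : Steers T z v := by
  obtain ⟨x, y, θ, ⟨hint, hx, hy, hθ⟩, h0, h1⟩ := hu
  refine ⟨x, y, θ, ⟨?_, hx, hy, fun t ht ↦ ?_⟩, h0, h1⟩
  · refine hint.congr_ae ?_
    rwa [uIoc_of_le hT.le]
  · rw [← integral_congr_of_ae_eq h ht, hθ t ht]

/-- The Hilbert space of square integrable controls on `[0, T]`. -/
abbrev L2Control (T : ℝ) : Type := Lp ℝ 2 (volume.restrict (Ioc 0 T))

theorem effort_coe {T : ℝ} (v : L2Control T) : effort T v = ENNReal.ofReal (‖v‖ ^ 2 / 2) := by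
  have h1 : ‖v‖ ^ 2 = ∫ t in Ioc 0 T, v t ^ 2 := by
    rw [← real_inner_self_eq_norm_sq, L2.inner_def]
    simp [pow_two]
  have h2 : Integrable (fun t ↦ v t ^ 2) (volume.restrict (Ioc 0 T)) := (Lp.memLp v).integrable_sq
  rw [h1, effort, ← Measure.restrict_congr_set Ioc_ae_eq_Icc, ← integral_div,
    ofReal_integral_eq_lintegral_ofReal (h2.div_const 2) (ae_of_all _ fun t ↦ by positivity)]

theorem memLp_of_effort_lt_top {T : ℝ} (hT : 0 < T) {u : ℝ → ℝ}
    (hu : IntervalIntegrable u volume 0 T) (h : effort T u < ∞) :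
    MemLp u 2 (volume.restrict (Ioc 0 T)) := by
  have hm : AEStronglyMeasurable u (volume.restrict (Ioc 0 T)) :=
    ((intervalIntegrable_iff_integrableOn_Ioc_of_le hT.le).1 hu).aestronglyMeasurable
  rw [effort, ← Measure.restrict_congr_set Ioc_ae_eq_Icc] at h
  have h1 := (lintegral_ofReal_ne_top_iff_integrable ((hm.pow 2).div₀ aestronglyMeasurable_const)
    (ae_of_all _ fun t ↦ (by positivity : 0 ≤ u t ^ 2 / 2))).1 h.ne
  rw [memLp_two_iff_integrable_sq hm]
  exact (h1.mul_const 2).congr (ae_of_all _ fun t ↦ by simp)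

theorem L2Control.intervalIntegrable {T : ℝ} (hT : 0 < T) (v : L2Control T) :
    IntervalIntegrable v volume 0 T :=
  (intervalIntegrable_iff_integrableOn_Ioc_of_le hT.le).2
    ((Lp.memLp v).integrable (by norm_num))

/-- The indicator of `(0, t]` as a square integrable control. -/
def indicatorControl (T t : ℝ) : L2Control T :=
  indicatorConstLp 2 (measurableSet_Ioc (a := (0 : ℝ)) (b := t)) (measure_ne_top _ _) (1 : ℝ)

/-- Makes the heading at a fixed time a weakly continuous function of the control. -/
theorem inner_indicatorControl {T t : ℝ} (ht : t ∈ Icc 0 T) (v : L2Control T) :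
    inner ℝ (indicatorControl T t) v = ∫ s in (0 : ℝ)..t, v s := by
  rw [indicatorControl, L2.inner_indicatorConstLp_one, intervalIntegral.integral_of_le ht.1,
    Measure.restrict_restrict measurableSet_Ioc,
    inter_eq_self_of_subset_left (Ioc_subset_Ioc_right ht.2)]

theorem norm_indicatorControl_le {T : ℝ} (hT : 0 < T) (t : ℝ) :
    ‖indicatorControl T t‖ ≤ T ^ (1 / 2 : ℝ) := by
  refine norm_indicatorConstLp_le.trans ?_
  rw [norm_one, one_mul, ENNReal.toReal_ofNat]
  gcongr
  have h : (volume.restrict (Ioc 0 T)).real (Ioc 0 t) ≤ (volume.restrict (Ioc 0 T)).real univ :=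
    measureReal_mono (subset_univ _)
  simpa [hT.le] using h

/-- Every controllable state has an optimal control. -/
theorem exists_isOptimalControl {T : ℝ} (hT : 0 < T) {z : State}
    (hz : z ∈ controllableSet T) : ∃ u, IsOptimalControl T z u := by
  obtain ⟨θ₀, hθ₀⟩ := exists_lift_eq z.2.2
  set S : Set (L2Control T) := {v | Steers T z v} with hS
  have htoLp : ∀ u, Steers T z u → effort T u < ∞ → ∃ v ∈ S, effort T v = effort T u := by
    intro u hu hfin
    have hmem := memLp_of_effort_lt_top hT hu.intervalIntegrable hfin
    exact ⟨hmem.toLp u, hu.congr hT hmem.coeFn_toLp.symm, effort_congr hmem.coeFn_toLp⟩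
  have hne : S.Nonempty := by
    obtain ⟨u, hu, hfin⟩ := exists_steers_effort_lt_top hT hz
    obtain ⟨v, hv, -⟩ := htoLp u hu hfin
    exact ⟨v, hv⟩
  have hbdd : BddBelow ((fun v : L2Control T ↦ ‖v‖) '' S) :=
    ⟨0, by rintro _ ⟨v, -, rfl⟩; exact norm_nonneg v⟩
  set m := sInf ((fun v : L2Control T ↦ ‖v‖) '' S) with hm
  obtain ⟨r, -, hr, hrS⟩ := exists_seq_tendsto_sInf (hne.image _) hbdd
  choose v hvS hvr using hrS
  have hvm : Tendsto (fun n ↦ ‖v n‖) atTop (𝓝 m) := by simpa only [hvr] using hr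
  obtain ⟨R, hR⟩ := hvm.bddAbove_range
  have hball : ∀ n, StrongDual.toWeakDual (InnerProductSpace.toDual ℝ (L2Control T) (v n)) ∈
      (WeakDual.toStrongDual ⁻¹' Metric.closedBall 0 R : Set (WeakDual ℝ (L2Control T))) := by
    intro n
    have : ‖v n‖ ≤ R := hR (mem_range_self n)
    simpa using this
  -- The finite exponent makes L² separable, as sequential Banach–Alaoglu requires.
  have : Fact ((2 : ℝ≥0∞) ≠ ∞) := ⟨ENNReal.ofNat_ne_top⟩
  obtain ⟨f, -, φ, hφ, hlim⟩ := WeakDual.isSeqCompact_closedBall ℝ (L2Control T) 0 R hball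
  obtain ⟨u, hu⟩ := (InnerProductSpace.toDual ℝ (L2Control T)).surjective (WeakDual.toStrongDual f)
  have hweak : ∀ w : L2Control T,
      Tendsto (fun n ↦ inner ℝ (v (φ n)) w) atTop (𝓝 (inner ℝ u w)) := by
    intro w
    have h := ((WeakDual.eval_continuous (𝕜 := ℝ) w).tendsto f).comp hlim
    have e : f w = inner ℝ u w := by
      rw [← InnerProductSpace.toDual_apply_apply, hu]; rfl
    rw [e] at h
    exact h
  have hprim : ∀ t ∈ Icc 0 T, Tendsto (fun n ↦ θ₀ + ∫ s in (0 : ℝ)..t, v (φ n) s) atTop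
      (𝓝 (θ₀ + ∫ s in (0 : ℝ)..t, u s)) := by
    intro t ht
    have h := hweak (indicatorControl T t)
    simp only [real_inner_comm (indicatorControl T t) _] at h
    simp only [inner_indicatorControl ht] at h
    exact h.const_add _
  have hcomp : ∀ g : ℝ → ℝ, Continuous g → (∀ x, ‖g x‖ ≤ 1) →
      Tendsto (fun n ↦ ∫ t in (0 : ℝ)..T, g (θ₀ + ∫ s in (0 : ℝ)..t, v (φ n) s)) atTop
        (𝓝 (∫ t in (0 : ℝ)..T, g (θ₀ + ∫ s in (0 : ℝ)..t, u s))) := by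
    intro g hg hg1
    refine intervalIntegral.tendsto_integral_filter_of_dominated_convergence (fun _ ↦ (1 : ℝ))
      (Eventually.of_forall fun n ↦ ?_) (Eventually.of_forall fun n ↦ ae_of_all _ fun t _ ↦ hg1 _)
      intervalIntegrable_const (ae_of_all _ fun t ht ↦ ?_)
    · have hc := hg.comp_continuousOn
        (continuousOn_heading hT (L2Control.intervalIntegrable hT (v (φ n))) θ₀)
      rw [uIoc_of_le hT.le]
      exact (hc.mono Ioc_subset_Icc_self).aestronglyMeasurable measurableSet_Ioc
    · rw [uIoc_of_le hT.le] at ht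
      exact (hg.tendsto _).comp (hprim t (Ioc_subset_Icc_self ht))
  have hsteer := fun n ↦ (steers_iff hT hθ₀).1 (hvS (φ n))
  have huS : u ∈ S := by
    refine (steers_iff hT hθ₀).2 ⟨L2Control.intervalIntegrable hT u, ?_, ?_, ?_⟩
    · have h := (hcomp Real.cos Real.continuous_cos Real.abs_cos_le_one).const_add z.1
      simp only [(hsteer _).2.1] at h
      exact tendsto_nhds_unique h tendsto_const_nhds
    · have h := (hcomp Real.sin Real.continuous_sin Real.abs_sin_le_one).const_add z.2.1
      simp only [(hsteer _).2.2.1] at h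
      exact tendsto_nhds_unique h tendsto_const_nhds
    · have h := (Real.Angle.continuous_coe.tendsto _).comp (hprim T ⟨hT.le, le_rfl⟩)
      simp only [Function.comp_def, (hsteer _).2.2.2] at h
      exact tendsto_nhds_unique h tendsto_const_nhds
  -- Weak lower semicontinuity: `⟪u, u⟫` is the limit of `⟪v (φ n), u⟫`, which is at most `‖v (φ n)‖
  -- * ‖u‖`.
  have hum : ‖u‖ ≤ m := by
    have h1 : inner ℝ u u ≤ m * ‖u‖ :=
      le_of_tendsto_of_tendsto' (hweak u) ((hvm.comp hφ.tendsto_atTop).mul_const ‖u‖)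
        fun n ↦ real_inner_le_norm _ _
    rw [real_inner_self_eq_norm_mul_norm] at h1
    rcases (norm_nonneg u).eq_or_lt with h0 | h0
    · rw [← h0]
      exact le_csInf (hne.image _) (by rintro _ ⟨v, -, rfl⟩; exact norm_nonneg v)
    · exact le_of_mul_le_mul_right h1 h0
  refine ⟨u, huS, fun w hw ↦ ?_⟩
  rcases eq_or_lt_of_le (le_top : effort T w ≤ ∞) with htop | hfin
  · rw [htop]; exact le_top
  · obtain ⟨w', hw', hwe⟩ := htoLp w hw hfin
    rw [← hwe, effort_coe, effort_coe]
    have : ‖u‖ ≤ ‖w'‖ := hum.trans (csInf_le hbdd ⟨w', hw', rfl⟩)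
    gcongr

/-! ### The multiplier rule and the form of optimal controls. -/

/-- The primitive of a square integrable control, as a continuous function. -/
def primitiveMap {T : ℝ} (hT : 0 < T) (v : L2Control T) : C(Icc 0 T, ℝ) where
  toFun t := ∫ s in (0 : ℝ)..t, v s
  continuous_toFun := by
    have h : ContinuousOn (fun t : ℝ ↦ ∫ s in (0 : ℝ)..t, v s) (Icc 0 T) := by
      simpa using continuousOn_heading hT (L2Control.intervalIntegrable hT v) 0
    exact h.domRestrict

theorem primitiveMap_apply {T : ℝ} (hT : 0 < T) (v : L2Control T) (t : Icc 0 T) :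
    primitiveMap hT v t = inner ℝ (indicatorControl T t) v :=
  (inner_indicatorControl t.2 v).symm

/-- The primitive, as a continuous linear map from square integrable controls to continuous
functions. -/
def primitiveCLM {T : ℝ} (hT : 0 < T) : L2Control T →L[ℝ] C(Icc 0 T, ℝ) :=
  LinearMap.mkContinuous
    { toFun := primitiveMap hT
      map_add' := fun v w ↦ by
        ext t
        simp only [ContinuousMap.add_apply, primitiveMap_apply, inner_add_right]
      map_smul' := fun c v ↦ by
        ext t
        simp only [ContinuousMap.smul_apply, RingHom.id_apply, smul_eq_mul, primitiveMap_apply,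
          inner_smul_right] }
    (T ^ (1 / 2 : ℝ)) fun v ↦ by
      refine (ContinuousMap.norm_le _ (by positivity)).2 fun t ↦ ?_
      simp only [LinearMap.coe_mk, AddHom.coe_mk, primitiveMap_apply]
      refine (norm_inner_le_norm _ _).trans ?_
      gcongr
      exact norm_indicatorControl_le hT _

theorem hasDerivWithinAt_primitive {T : ℝ} (hT : 0 < T) {f : ℝ → ℝ}
    (hf : ContinuousOn f (Icc 0 T)) {t : ℝ} (ht : t ∈ Icc 0 T) :
    HasDerivWithinAt (fun t ↦ ∫ s in (0 : ℝ)..t, f s) (f t) (Icc 0 T) t := by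
  -- Constant extension beyond the interval makes the fundamental theorem available at the
  -- endpoints.
  set F : ℝ → ℝ := IccExtend hT.le ((Icc 0 T).domRestrict f)
  have hF : Continuous F := continuous_IccExtend_iff.2 hf.domRestrict
  have hFf : ∀ s ∈ Icc 0 T, F s = f s := fun s hs ↦ IccExtend_of_mem hT.le _ hs
  have h := (hF.integral_hasStrictDerivAt 0 t).hasDerivAt.hasDerivWithinAt (s := Icc 0 T)
  rw [hFf t ht] at h
  have hint : ∀ r ∈ Icc 0 T, ∫ s in (0 : ℝ)..r, f s = ∫ s in (0 : ℝ)..r, F s := by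
    intro r hr
    refine intervalIntegral.integral_congr fun s hs ↦ ?_
    rw [uIcc_of_le hr.1] at hs
    exact (hFf s ⟨hs.1, hs.2.trans hr.2⟩).symm
  exact h.congr hint (hint t ht)

/-- The derivative of the terminal heading and of the displacement with respect to the control. -/
def terminalDeriv {T : ℝ} (hT : 0 < T) (θ : C(Icc 0 T, ℝ)) : L2Control T →L[ℝ] ℝ × ℝ × ℝ :=
  ((ContinuousMap.evalCLM ℝ ⟨T, right_mem_Icc.2 hT.le⟩).prod
    ((integralMulCLM (volIcc T) (negSin.comp θ)).prod
      (integralMulCLM (volIcc T) (cosMap.comp θ)))).comp (primitiveCLM hT)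

theorem hasStrictFDerivAt_terminal {T : ℝ} (hT : 0 < T) (θ₀ : C(Icc 0 T, ℝ)) (v : L2Control T) :
    HasStrictFDerivAt (fun w ↦ ((θ₀ + primitiveCLM hT w) ⟨T, right_mem_Icc.2 hT.le⟩,
        ∫ t, Real.cos ((θ₀ + primitiveCLM hT w) t) ∂volIcc T,
        ∫ t, Real.sin ((θ₀ + primitiveCLM hT w) t) ∂volIcc T))
      (terminalDeriv hT (θ₀ + primitiveCLM hT v)) v := by
  have h1 : HasStrictFDerivAt (fun w ↦ θ₀ + primitiveCLM hT w) (primitiveCLM hT) v :=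
    (primitiveCLM hT).hasStrictFDerivAt.const_add θ₀
  exact HasStrictFDerivAt.comp (g := fun φ : C(Icc 0 T, ℝ) ↦ (φ ⟨T, right_mem_Icc.2 hT.le⟩,
    ∫ t, Real.cos (φ t) ∂volIcc T, ∫ t, Real.sin (φ t) ∂volIcc T)) v
    ((ContinuousMap.evalCLM ℝ _).hasStrictFDerivAt.prodMk
      ((hasStrictFDerivAt_integral_cos _).prodMk (hasStrictFDerivAt_integral_sin _))) h1

theorem memLp_of_continuousOn {T : ℝ} {f : ℝ → ℝ} (hf : ContinuousOn f (Icc 0 T)) :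
    MemLp f 2 (volume.restrict (Ioc 0 T)) := by
  obtain ⟨C, hC⟩ := isCompact_Icc.exists_bound_of_continuousOn hf
  exact MemLp.of_bound ((hf.mono Ioc_subset_Icc_self).aestronglyMeasurable measurableSet_Ioc) C
    (ae_restrict_of_forall_mem measurableSet_Ioc fun t ht ↦ hC t (Ioc_subset_Icc_self ht))

theorem inner_eq_intervalIntegral {T : ℝ} (hT : 0 < T) (v w : L2Control T) :
    inner ℝ v w = ∫ t in (0 : ℝ)..T, v t * w t := by
  rw [L2.inner_def, intervalIntegral.integral_of_le hT.le]
  simp [mul_comm]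

/-- The Lagrange multiplier rule for optimal controls: `(a, b, c, d)` is nontrivial and
`a + b y - c x + d u = 0`. -/
theorem IsOptimalControl.exists_multipliers {T : ℝ} (hT : 0 < T) {z : State} {u : ℝ → ℝ}
    (hu : IsOptimalControl T z u) {θ₀ : ℝ} (hθ₀ : (θ₀ : Real.Angle) = z.2.2) :
    ∃ a b c d : ℝ, ¬ (a = 0 ∧ b = 0 ∧ c = 0 ∧ d = 0) ∧ ∀ᵐ t ∂volume.restrict (Ioc 0 T),
      a + b * (z.2.1 + ∫ r in (0 : ℝ)..t, Real.sin (θ₀ + ∫ s in (0 : ℝ)..r, u s))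
        - c * (z.1 + ∫ r in (0 : ℝ)..t, Real.cos (θ₀ + ∫ s in (0 : ℝ)..r, u s)) + d * u t = 0 := by
  obtain ⟨u₁, hu₁, hfin₁⟩ := exists_steers_effort_lt_top hT ⟨u, hu.1⟩
  have hmem := memLp_of_effort_lt_top hT hu.1.intervalIntegrable ((hu.2 u₁ hu₁).trans_lt hfin₁)
  set v := hmem.toLp u
  have hvu : v =ᵐ[volume.restrict (Ioc 0 T)] u := hmem.coeFn_toLp
  obtain ⟨hint, hxT, hyT, hθT⟩ := (steers_iff hT hθ₀).1 hu.1
  set θ : ℝ → ℝ := fun t ↦ θ₀ + ∫ s in (0 : ℝ)..t, u s with hθdef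
  have hθ : ContinuousOn θ (Icc 0 T) := continuousOn_heading hT hint θ₀
  set c₀ : C(Icc 0 T, ℝ) := ContinuousMap.const _ θ₀
  have hval : ∀ w : L2Control T, ∀ t : Icc 0 T, (c₀ + primitiveCLM hT w) t
      = θ₀ + ∫ s in (0 : ℝ)..t, w s := fun w t ↦ rfl
  have hvalv : ∀ t : Icc 0 T, (c₀ + primitiveCLM hT v) t = θ t := by
    intro t
    rw [hval, integral_congr_of_ae_eq hvu t.2]
  -- The constraint fixes the real terminal heading, not its class modulo `2π`. This only shrinks
  -- the set of competitors, so `v` remains a minimizer.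
  have hextr : IsLocalExtrOn (fun w : L2Control T ↦ ‖w‖ ^ 2)
      {w | (fun w ↦ ((c₀ + primitiveCLM hT w) ⟨T, right_mem_Icc.2 hT.le⟩,
        ∫ t, Real.cos ((c₀ + primitiveCLM hT w) t) ∂volIcc T,
        ∫ t, Real.sin ((c₀ + primitiveCLM hT w) t) ∂volIcc T)) w =
        (fun w ↦ ((c₀ + primitiveCLM hT w) ⟨T, right_mem_Icc.2 hT.le⟩,
        ∫ t, Real.cos ((c₀ + primitiveCLM hT w) t) ∂volIcc T,
        ∫ t, Real.sin ((c₀ + primitiveCLM hT w) t) ∂volIcc T)) v} v := by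
    refine IsMinFilter.isExtr (IsMinOn.localize fun w hw ↦ ?_)
    simp only [mem_ofPred_eq, Prod.mk.injEq] at hw
    obtain ⟨h1, h2, h3⟩ := hw
    have hw : Steers T z w := by
      refine (steers_iff hT hθ₀).2 ⟨L2Control.intervalIntegrable hT w, ?_, ?_, ?_⟩
      · refine Eq.trans (congrArg (z.1 + ·) ?_) hxT
        rw [← integral_Icc_coe hT.le (fun t ↦ Real.cos (θ₀ + ∫ s in (0 : ℝ)..t, w s)),
          ← integral_Icc_coe hT.le (fun t ↦ Real.cos (θ t))]
        simp only [← hval, ← hvalv]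
        exact h2
      · refine Eq.trans (congrArg (z.2.1 + ·) ?_) hyT
        rw [← integral_Icc_coe hT.le (fun t ↦ Real.sin (θ₀ + ∫ s in (0 : ℝ)..t, w s)),
          ← integral_Icc_coe hT.le (fun t ↦ Real.sin (θ t))]
        simp only [← hval, ← hvalv]
        exact h3
      · have h4 : θ₀ + ∫ s in (0 : ℝ)..T, w s = θ T := h1.trans (hvalv _)
        rw [h4]; exact hθT
    have h5 := hu.2 w hw
    rw [← effort_congr hvu, effort_coe, effort_coe,
      ENNReal.ofReal_le_ofReal_iff (by positivity)] at h5
    show ‖v‖ ^ 2 ≤ ‖w‖ ^ 2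
    linarith
  obtain ⟨Λ, Λ₀, hne, hΛ⟩ := hextr.exists_linear_map_of_hasStrictFDerivAt
    (hasStrictFDerivAt_terminal hT c₀ v) (hasStrictFDerivAt_norm_sq v)
  set a := Λ (1, 0, 0)
  set b := Λ (0, 1, 0)
  set c := Λ (0, 0, 1)
  have hrep : ∀ x y z : ℝ, Λ (x, y, z) = x * a + y * b + z * c := by
    intro x y z
    have : (x, y, z) = x • ((1, 0, 0) : ℝ × ℝ × ℝ) + y • (0, 1, 0) + z • (0, 0, 1) := by simp
    rw [this, map_add, map_add, map_smul, map_smul, map_smul]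
    simp only [smul_eq_mul, a, b, c]
  have hs : ContinuousOn (fun t ↦ Real.sin (θ t)) (Icc 0 T) :=
    Real.continuous_sin.comp_continuousOn hθ
  have hsn : ContinuousOn (fun t ↦ -Real.sin (θ t)) (Icc 0 T) := hs.neg
  have hc : ContinuousOn (fun t ↦ Real.cos (θ t)) (Icc 0 T) :=
    Real.continuous_cos.comp_continuousOn hθ
  have hii : ∀ {f : ℝ → ℝ}, ContinuousOn f (Icc 0 T) → ∀ t ∈ Icc 0 T,
      IntervalIntegrable f volume 0 t := fun hf t ht ↦
    (hf.mono (Icc_subset_Icc_right ht.2)).intervalIntegrable_of_Icc ht.1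
  have hTm : T ∈ Icc 0 T := ⟨hT.le, le_rfl⟩
  set x : ℝ → ℝ := fun t ↦ z.1 + ∫ r in (0 : ℝ)..t, Real.cos (θ r) with hx
  set y : ℝ → ℝ := fun t ↦ z.2.1 + ∫ r in (0 : ℝ)..t, Real.sin (θ r) with hy
  have hxc : ContinuousOn x (Icc 0 T) := continuousOn_heading hT (hii hc T hTm) _
  have hyc : ContinuousOn y (Icc 0 T) := continuousOn_heading hT (hii hs T hTm) _
  have hWc : ContinuousOn (fun t ↦ a + b * y t - c * x t) (Icc 0 T) := by fun_prop
  set W : L2Control T := (memLp_of_continuousOn hWc).toLp _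
  have hW : W =ᵐ[volume.restrict (Ioc 0 T)] fun t ↦ a + b * y t - c * x t :=
    (memLp_of_continuousOn hWc).coeFn_toLp
  -- Integration by parts moves the primitive off `w`; since the path ends at the origin, the
  -- integral from `t` to `T` of the weight is `b * y t - c * x t`.
  have horth : ∀ w : L2Control T, inner ℝ (W + (2 * Λ₀) • v) w = 0 := by
    intro w
    have hwi := L2Control.intervalIntegrable hT w
    have hPc : ContinuousOn (fun t ↦ ∫ s in (0 : ℝ)..t, w s) (Icc 0 T) := by
      simpa using continuousOn_heading hT hwi 0
    have h1 := hΛ w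
    have h2 : terminalDeriv hT (c₀ + primitiveCLM hT v) w = (∫ s in (0 : ℝ)..T, w s,
        ∫ t in (0 : ℝ)..T, -Real.sin (θ t) * ∫ s in (0 : ℝ)..t, w s,
        ∫ t in (0 : ℝ)..T, Real.cos (θ t) * ∫ s in (0 : ℝ)..t, w s) := by
      rw [← integral_Icc_coe hT.le (fun t ↦ -Real.sin (θ t) * ∫ s in (0 : ℝ)..t, w s),
        ← integral_Icc_coe hT.le (fun t ↦ Real.cos (θ t) * ∫ s in (0 : ℝ)..t, w s)]
      simp only [← hvalv]
      rfl
    have h3 : (2 • innerSL ℝ v) w = 2 * inner ℝ v w := by simp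
    rw [h2, hrep, h3, smul_eq_mul] at h1
    have hgc : ContinuousOn (fun t ↦ b * -Real.sin (θ t) + c * Real.cos (θ t)) (Icc 0 T) := by
      fun_prop
    have h4 := integral_mul_primitive (hii hgc T hTm) hwi
    have h5 : ∀ t ∈ Icc 0 T, ∫ s in (0 : ℝ)..t, (b * -Real.sin (θ s) + c * Real.cos (θ s))
        = -b * (y t - z.2.1) + c * (x t - z.1) := by
      intro t ht
      rw [intervalIntegral.integral_add ((hii hsn t ht).const_mul b) ((hii hc t ht).const_mul c),
        intervalIntegral.integral_const_mul, intervalIntegral.integral_const_mul,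
        intervalIntegral.integral_neg]
      simp only [hx, hy]
      ring
    have hsP : ContinuousOn (fun t ↦ -Real.sin (θ t) * ∫ s in (0 : ℝ)..t, w s) (Icc 0 T) :=
      hsn.mul hPc
    have hcP : ContinuousOn (fun t ↦ Real.cos (θ t) * ∫ s in (0 : ℝ)..t, w s) (Icc 0 T) :=
      hc.mul hPc
    have h6 : (∫ t in (0 : ℝ)..T, -Real.sin (θ t) * ∫ s in (0 : ℝ)..t, w s) * b
        + (∫ t in (0 : ℝ)..T, Real.cos (θ t) * ∫ s in (0 : ℝ)..t, w s) * c
        = ∫ t in (0 : ℝ)..T, (b * -Real.sin (θ t) + c * Real.cos (θ t)) *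
            ∫ s in (0 : ℝ)..t, w s := by
      rw [← intervalIntegral.integral_mul_const, ← intervalIntegral.integral_mul_const,
        ← intervalIntegral.integral_add ((hii hsP T hTm).mul_const b)
          ((hii hcP T hTm).mul_const c)]
      refine intervalIntegral.integral_congr fun t _ ↦ ?_
      ring
    have h7 : inner ℝ W w = (∫ s in (0 : ℝ)..T, w s) * a + ∫ t in (0 : ℝ)..T,
        ((∫ s in (0 : ℝ)..T, (b * -Real.sin (θ s) + c * Real.cos (θ s)))
          - ∫ s in (0 : ℝ)..t, (b * -Real.sin (θ s) + c * Real.cos (θ s))) * w t := by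
      rw [inner_eq_intervalIntegral hT, ← intervalIntegral.integral_mul_const,
        ← intervalIntegral.integral_add (hwi.mul_const a)]
      · rw [intervalIntegral.integral_of_le hT.le, intervalIntegral.integral_of_le hT.le]
        refine integral_congr_ae ?_
        filter_upwards [hW, ae_restrict_mem measurableSet_Ioc] with t ht htm
        rw [ht, h5 T hTm, h5 t (Ioc_subset_Icc_self htm)]
        have hxT' : x T = 0 := hxT
        have hyT' : y T = 0 := hyT
        rw [hxT', hyT']
        ring
      · refine hwi.continuousOn_mul ?_
        rw [uIcc_of_le hT.le]
        refine continuousOn_const.sub ?_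
        simpa using continuousOn_heading hT (hii hgc T hTm) 0
    rw [inner_add_left, inner_smul_left, h7, ← h4, ← h6]
    simp only [conj_trivial]
    linarith
  have hzero : W + (2 * Λ₀) • v = 0 := inner_self_eq_zero.1 (horth _)
  refine ⟨a, b, c, 2 * Λ₀, ?_, ?_⟩
  · rintro ⟨ha, hb, hc, hd⟩
    apply hne
    refine Prod.ext (LinearMap.ext fun p ↦ ?_) (by simpa using hd)
    obtain ⟨p₁, p₂, p₃⟩ := p
    simp only
    rw [hrep, ha, hb, hc]
    simp
  · have h0 := Lp.coeFn_zero ℝ 2 (volume.restrict (Ioc 0 T))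
    rw [← hzero] at h0
    filter_upwards [h0, Lp.coeFn_add W ((2 * Λ₀) • v), Lp.coeFn_smul (2 * Λ₀) v, hW, hvu]
      with t h1 h2 h3 h4 h5
    rw [h2, Pi.add_apply, h3, Pi.smul_apply, h4, h5] at h1
    exact h1

/-- An optimal control coincides with an affine function of the position along its trajectory. -/
theorem IsOptimalControl.exists_ae_eq {T : ℝ} (hT : 0 < T) {z : State} {u : ℝ → ℝ}
    (hu : IsOptimalControl T z u) {θ₀ : ℝ} (hθ₀ : (θ₀ : Real.Angle) = z.2.2) :
    ∃ q : ℝ × ℝ × ℝ, u =ᵐ[volume.restrict (Ioc 0 T)] fun t ↦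
      q.1 * (z.2.1 + ∫ r in (0 : ℝ)..t, Real.sin (θ₀ + ∫ s in (0 : ℝ)..r, u s))
        - q.2.1 * (z.1 + ∫ r in (0 : ℝ)..t, Real.cos (θ₀ + ∫ s in (0 : ℝ)..r, u s)) + q.2.2 := by
  obtain ⟨a, b, c, d, hne, h⟩ := hu.exists_multipliers hT hθ₀
  by_cases hd : d = 0
  · subst hd
    -- Abnormal case: the relation confines the path to a line, and its derivative makes the heading
    -- constant. The zero control then steers, so the minimal effort is zero and `q = 0` works.
    have hint := hu.1.intervalIntegrable
    have hθ := continuousOn_heading hT hint θ₀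
    set θ : ℝ → ℝ := fun t ↦ θ₀ + ∫ s in (0 : ℝ)..t, u s with hθdef
    have hs : ContinuousOn (fun t ↦ Real.sin (θ t)) (Icc 0 T) :=
      Real.continuous_sin.comp_continuousOn hθ
    have hc : ContinuousOn (fun t ↦ Real.cos (θ t)) (Icc 0 T) :=
      Real.continuous_cos.comp_continuousOn hθ
    have hder : ∀ t ∈ Icc 0 T, HasDerivWithinAt (fun t ↦
        a + b * (z.2.1 + ∫ r in (0 : ℝ)..t, Real.sin (θ r))
          - c * (z.1 + ∫ r in (0 : ℝ)..t, Real.cos (θ r)))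
        (b * Real.sin (θ t) - c * Real.cos (θ t)) (Icc 0 T) t := fun t ht ↦
      ((((hasDerivWithinAt_primitive hT hs ht).const_add _).const_mul b).const_add a).sub
        (((hasDerivWithinAt_primitive hT hc ht).const_add _).const_mul c)
    have hzero := Measure.eqOn_Icc_of_ae_eq volume hT.ne (g := fun _ ↦ (0 : ℝ))
      (by
        rw [← Measure.restrict_congr_set Ioc_ae_eq_Icc]
        filter_upwards [h] with t ht
        simpa only [zero_mul, add_zero] using ht)
      (fun t ht ↦ (hder t ht).continuousWithinAt) continuousOn_const
    have horth : ∀ t ∈ Icc 0 T, b * Real.sin (θ t) + (-c) * Real.cos (θ t) = 0 := by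
      intro t ht
      have h1 := (hasDerivWithinAt_const t (Icc 0 T) (0 : ℝ)).congr hzero (hzero ht)
      have h2 := (uniqueDiffOn_Icc hT t ht).eq_deriv _ (hder t ht) h1
      linarith
    have hbc : b ≠ 0 ∨ -c ≠ 0 := by
      by_contra! hbc
      obtain ⟨rfl, hc0⟩ := hbc
      obtain rfl : c = 0 := neg_eq_zero.1 hc0
      have h1 := hzero (left_mem_Icc.2 hT.le)
      simp only [zero_mul, add_zero, sub_zero] at h1
      exact hne ⟨h1, rfl, rfl, rfl⟩
    have hconst := eq_of_forall_sin_add_cos_eq_zero hT hθ hbc horth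
    have hθ0 : θ 0 = θ₀ := by simp [hθdef]
    have hsteer := hu.1.zero_of_heading_const hT hθ₀ fun t ht ↦ (hconst t ht).trans hθ0
    have heff : effort T u = 0 := by
      refine le_antisymm ((hu.2 _ hsteer).trans (le_of_eq ?_)) zero_le
      simp [effort]
    have hmem := memLp_of_effort_lt_top hT hint (heff ▸ ENNReal.zero_lt_top)
    rw [← effort_congr hmem.coeFn_toLp, effort_coe, ENNReal.ofReal_eq_zero] at heff
    have h0 : hmem.toLp u = 0 := by
      rw [← norm_eq_zero, ← sq_eq_zero_iff]
      nlinarith [sq_nonneg ‖hmem.toLp u‖]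
    refine ⟨0, ?_⟩
    have h1 := Lp.coeFn_zero ℝ 2 (volume.restrict (Ioc 0 T))
    rw [← h0] at h1
    filter_upwards [h1, hmem.coeFn_toLp] with t h2 h3
    rw [← h3, h2]
    simp
  · refine ⟨(-b / d, -c / d, -a / d), ?_⟩
    filter_upwards [h] with t ht
    field_simp
    linarith

/-! ### Optimal trajectories as reversed backward solutions. -/

/-- Intervals `(0, ε)` are not null; this makes the essential limit unique. -/
theorem neBot_nhdsGT_inf_ae : (𝓝[>] (0 : ℝ) ⊓ ae volume).NeBot := by
  rw [Filter.inf_neBot_iff]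
  intro s hs s' hs'
  by_contra hemp
  obtain ⟨ε, hε, hsub⟩ := (mem_nhdsGT_iff_exists_Ioo_subset).1 hs
  have h1 : Ioo 0 ε ⊆ s'ᶜ := fun t ht ht' ↦ hemp ⟨t, hsub ht, ht'⟩
  have h2 := measure_mono_null h1 hs'
  rw [Real.volume_Ioo, sub_zero, ENNReal.ofReal_eq_zero] at h2
  exact h2.not_gt hε

theorem exists_lipschitzWith_backwardField (q : ℝ × ℝ × ℝ) :
    ∃ K, LipschitzWith K (backwardField q) := by
  have hp : LipschitzWith 1 (fun w : ℝ × ℝ × ℝ ↦ w.2.2) := by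
    simpa using! LipschitzWith.prod_snd.comp LipschitzWith.prod_snd
  have hx : LipschitzWith 1 (fun w : ℝ × ℝ × ℝ ↦ w.1) := LipschitzWith.prod_fst
  have hy : LipschitzWith 1 (fun w : ℝ × ℝ × ℝ ↦ w.2.1) := by
    simpa using! LipschitzWith.prod_fst.comp LipschitzWith.prod_snd
  have hm : ∀ c : ℝ, LipschitzWith ‖c‖₊ fun y : ℝ ↦ c * y := fun c ↦
    lipschitzWith_smul c
  exact ⟨_, (Real.lipschitzWith_cos.comp hp).neg.prodMk ((Real.lipschitzWith_sin.comp hp).neg.prodMk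
    ((((hm q.1).comp hy).sub ((hm q.2.1).comp hx)).add (LipschitzWith.const q.2.2)).neg)⟩

/-- A trajectory whose control is affine in the position is a backward solution traversed in
reverse, and the control has an initial value. -/
theorem exists_eq_Z_of_ae_eq {T : ℝ} (hT : 0 < T) {z : State} {u : ℝ → ℝ} (hu : Steers T z u)
    {θ₀ : ℝ} (hθ₀ : (θ₀ : Real.Angle) = z.2.2) {q : ℝ × ℝ × ℝ}
    (hq : u =ᵐ[volume.restrict (Ioc 0 T)] fun t ↦
      q.1 * (z.2.1 + ∫ r in (0 : ℝ)..t, Real.sin (θ₀ + ∫ s in (0 : ℝ)..r, u s))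
        - q.2.1 * (z.1 + ∫ r in (0 : ℝ)..t, Real.cos (θ₀ + ∫ s in (0 : ℝ)..r, u s)) + q.2.2) :
    z = Z T q ∧ HasInitialValue u (U T q) := by
  obtain ⟨hint, hxT, hyT, hθT⟩ := (steers_iff hT hθ₀).1 hu
  have hθ := continuousOn_heading hT hint θ₀
  set θ : ℝ → ℝ := fun t ↦ θ₀ + ∫ s in (0 : ℝ)..t, u s with hθdef
  have hs : ContinuousOn (fun t ↦ Real.sin (θ t)) (Icc 0 T) :=
    Real.continuous_sin.comp_continuousOn hθ
  have hc : ContinuousOn (fun t ↦ Real.cos (θ t)) (Icc 0 T) :=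
    Real.continuous_cos.comp_continuousOn hθ
  set x : ℝ → ℝ := fun t ↦ z.1 + ∫ r in (0 : ℝ)..t, Real.cos (θ r) with hxdef
  set y : ℝ → ℝ := fun t ↦ z.2.1 + ∫ r in (0 : ℝ)..t, Real.sin (θ r) with hydef
  have hx : ∀ t ∈ Icc 0 T, HasDerivWithinAt x (Real.cos (θ t)) (Icc 0 T) t := fun t ht ↦
    (hasDerivWithinAt_primitive hT hc ht).const_add _
  have hy : ∀ t ∈ Icc 0 T, HasDerivWithinAt y (Real.sin (θ t)) (Icc 0 T) t := fun t ht ↦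
    (hasDerivWithinAt_primitive hT hs ht).const_add _
  have hxc : ContinuousOn x (Icc 0 T) := fun t ht ↦ (hx t ht).continuousWithinAt
  have hyc : ContinuousOn y (Icc 0 T) := fun t ht ↦ (hy t ht).continuousWithinAt
  have hfc : ContinuousOn (fun t ↦ q.1 * y t - q.2.1 * x t + q.2.2) (Icc 0 T) := by fun_prop
  have hθ' : ∀ t ∈ Icc 0 T,
      HasDerivWithinAt θ (q.1 * y t - q.2.1 * x t + q.2.2) (Icc 0 T) t := by
    intro t ht
    have h1 := (hasDerivWithinAt_primitive hT hfc ht).const_add θ₀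
    have h2 : ∀ r ∈ Icc 0 T, θ r = θ₀ + ∫ s in (0 : ℝ)..r, (q.1 * y s - q.2.1 * x s + q.2.2) :=
      fun r hr ↦ congrArg (θ₀ + ·) (integral_congr_of_ae_eq hq hr)
    exact h1.congr h2 (h2 t ht)
  -- The lift ends at `-π/2` only up to `2πk`, but the backward solution starts there exactly; hence
  -- the shift in `w`.
  obtain ⟨k, hk⟩ := Real.Angle.angle_eq_iff_two_pi_dvd_sub.1 hθT
  set w : ℝ → ℝ × ℝ × ℝ := fun s ↦ (x (T - s), y (T - s), θ (T - s) - 2 * Real.pi * k) with hw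
  have hper : ∀ t, Real.cos (t - 2 * Real.pi * k) = Real.cos t ∧
      Real.sin (t - 2 * Real.pi * k) = Real.sin t := by
    intro t
    rw [mul_comm]
    exact ⟨Real.cos_sub_int_mul_two_pi t k, Real.sin_sub_int_mul_two_pi t k⟩
  have hmaps : MapsTo (fun s ↦ T - s) (Icc 0 T) (Icc 0 T) := fun s hs ↦
    ⟨sub_nonneg.2 hs.2, sub_le_self _ hs.1⟩
  have hw' : ∀ s ∈ Icc 0 T, HasDerivWithinAt w (backwardField q (w s)) (Icc 0 T) s := by
    intro s hs
    have hsub : HasDerivWithinAt (fun s ↦ T - s) (-1) (Icc 0 T) s := by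
      simpa using ((hasDerivAt_id s).const_sub T).hasDerivWithinAt
    have h1 := (hx _ (hmaps hs)).scomp s hsub hmaps
    have h2 := (hy _ (hmaps hs)).scomp s hsub hmaps
    have h3 := ((hθ' _ (hmaps hs)).scomp s hsub hmaps).sub_const (2 * Real.pi * k)
    have h4 := h1.prodMk (h2.prodMk h3)
    simp only [smul_eq_mul, neg_mul, one_mul] at h4
    simp only [backwardField, hw, (hper _).1, (hper _).2]
    exact h4
  obtain ⟨K, hK⟩ := exists_lipschitzWith_backwardField q
  obtain ⟨hb0, hb⟩ := backwardSolution_spec q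
  have hright : ∀ s ∈ Ico 0 T, Icc 0 T ∈ 𝓝[≥] s := fun s hs ↦ Icc_mem_nhdsGE_of_mem hs
  have heq := ODE_solution_unique_of_mem_Icc_right (v := fun _ ↦ backwardField q)
    (s := fun _ ↦ univ) (K := K) (f := w) (g := backwardSolution q) (a := 0) (b := T)
    (fun _ _ ↦ hK.lipschitzOnWith) (fun s hs ↦ (hw' s hs).continuousWithinAt)
    (fun s hs ↦ (hw' s (Ico_subset_Icc_self hs)).mono_of_mem_nhdsWithin (hright s hs))
    (fun _ _ ↦ trivial) (fun s _ ↦ (hb s).continuousAt.continuousWithinAt)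
    (fun s _ ↦ (hb s).hasDerivWithinAt) (fun _ _ ↦ trivial)
    (by
      rw [hb0, hw]
      simp only [sub_zero]
      refine Prod.ext hxT (Prod.ext hyT ?_)
      show θ T - 2 * Real.pi * k = -(Real.pi / 2)
      have : θ T - -(Real.pi / 2) = 2 * Real.pi * k := hk
      linarith)
  have hbT := (heq (right_mem_Icc.2 hT.le)).symm
  have hw1 : w T = (z.1, z.2.1, θ₀ - 2 * Real.pi * k) := by
    simp [hw, hxdef, hydef, hθdef]
  rw [hw1] at hbT
  refine ⟨?_, ?_⟩
  · rw [Z, hbT]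
    refine Prod.ext rfl (Prod.ext rfl ?_)
    show z.2.2 = ((θ₀ - 2 * Real.pi * k : ℝ) : Real.Angle)
    rw [← hθ₀, Real.Angle.angle_eq_iff_two_pi_dvd_sub]
    exact ⟨k, by ring⟩
  · have hU : U T q = q.1 * y 0 - q.2.1 * x 0 + q.2.2 := by
      rw [U, hbT]
      simp [hxdef, hydef]
    rw [hU]
    -- The affine expression is continuous at `0` from the right and agrees with `u` almost
    -- everywhere, so its value there is the essential limit.
    have h0 : Tendsto (fun t ↦ q.1 * y t - q.2.1 * x t + q.2.2) (𝓝[>] 0 ⊓ ae volume)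
        (𝓝 (q.1 * y 0 - q.2.1 * x 0 + q.2.2)) := by
      refine (hfc 0 (left_mem_Icc.2 hT.le)).mono_left (inf_le_left.trans ?_)
      exact nhdsWithin_le_of_mem (mem_of_superset (Ioc_mem_nhdsGT hT) Ioc_subset_Icc_self)
    refine h0.congr' ?_
    filter_upwards [mem_inf_of_left (Ioc_mem_nhdsGT hT),
      mem_inf_of_right ((ae_restrict_iff' measurableSet_Ioc).1 hq)] with t ht hqt
    exact (hqt ht).symm

/-- Under `t ↦ T - t` the signs in the backward field cancel, leaving a trajectory with a continuous
control. -/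
theorem Z_mem_controllableSet (T : ℝ) (q : ℝ × ℝ × ℝ) :
    Z T q ∈ controllableSet T := by
  obtain ⟨hb0, hb⟩ := backwardSolution_spec q
  set w := backwardSolution q with hw
  have hrev : ∀ t, HasDerivAt (fun t ↦ w (T - t)) (-backwardField q (w (T - t))) t := by
    intro t
    have h := (hb (T - t)).scomp t ((hasDerivAt_id t).const_sub T)
    rw [neg_one_smul] at h
    exact h
  have hsnd : ∀ t, HasDerivAt (fun t ↦ (w (T - t)).2) (-backwardField q (w (T - t))).2 t := fun t ↦
    (ContinuousLinearMap.snd ℝ ℝ (ℝ × ℝ)).hasFDerivAt.comp_hasDerivAt t (hrev t)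
  have hx : ∀ t, HasDerivAt (fun t ↦ (w (T - t)).1) (Real.cos (w (T - t)).2.2) t := fun t ↦ by
    have h := (ContinuousLinearMap.fst ℝ ℝ (ℝ × ℝ)).hasFDerivAt.comp_hasDerivAt t (hrev t)
    exact h.congr_deriv (neg_neg _)
  have hy : ∀ t, HasDerivAt (fun t ↦ (w (T - t)).2.1) (Real.sin (w (T - t)).2.2) t := fun t ↦ by
    have h := (ContinuousLinearMap.fst ℝ ℝ ℝ).hasFDerivAt.comp_hasDerivAt t (hsnd t)
    exact h.congr_deriv (neg_neg _)
  have hθ : ∀ t, HasDerivAt (fun t ↦ (w (T - t)).2.2)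
      (q.1 * (w (T - t)).2.1 - q.2.1 * (w (T - t)).1 + q.2.2) t := fun t ↦ by
    have h := (ContinuousLinearMap.snd ℝ ℝ ℝ).hasFDerivAt.comp_hasDerivAt t (hsnd t)
    exact h.congr_deriv (neg_neg _)
  have hcx : Continuous fun t ↦ (w (T - t)).1 :=
    continuous_iff_continuousAt.2 fun t ↦ (hx t).continuousAt
  have hcy : Continuous fun t ↦ (w (T - t)).2.1 :=
    continuous_iff_continuousAt.2 fun t ↦ (hy t).continuousAt
  have hcθ : Continuous fun t ↦ (w (T - t)).2.2 :=
    continuous_iff_continuousAt.2 fun t ↦ (hθ t).continuousAt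
  have hcu : Continuous fun t ↦ q.1 * (w (T - t)).2.1 - q.2.1 * (w (T - t)).1 + q.2.2 := by
    fun_prop
  refine ⟨fun t ↦ q.1 * (w (T - t)).2.1 - q.2.1 * (w (T - t)).1 + q.2.2,
    fun t ↦ (w (T - t)).1, fun t ↦ (w (T - t)).2.1, fun t ↦ (w (T - t)).2.2,
    ⟨hcu.intervalIntegrable _ _, fun t _ ↦ ?_, fun t _ ↦ ?_, fun t _ ↦ ?_⟩, ?_, ?_⟩
  · rw [intervalIntegral.integral_eq_sub_of_hasDerivAt (fun s _ ↦ hx s)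
      ((Real.continuous_cos.comp hcθ).intervalIntegrable _ _)]
    ring
  · rw [intervalIntegral.integral_eq_sub_of_hasDerivAt (fun s _ ↦ hy s)
      ((Real.continuous_sin.comp hcθ).intervalIntegrable _ _)]
    ring
  · rw [intervalIntegral.integral_eq_sub_of_hasDerivAt (fun s _ ↦ hθ s)
      (hcu.intervalIntegrable _ _)]
    ring
  · simp only [sub_zero, Z, hw]
  · simp only [sub_self, hb0, finalState]

end Guidance

end

open Guidance
/-- For every `z ∈ 𝒵_T` an optimal control exists and every optimal control has a value at the
initial time, so the optimal feedback `N(z)` is meaningful; every value of `N(z)` is `U(T, q)` for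
a `q` with `z = Z(T, q)`; and every `Z(T, q)` lies in `𝒵_T`. -/
theorem lemma4 (T : ℝ) (hT : 0 < T) :
    (∀ z ∈ controllableSet T,
      ((∃ u, IsOptimalControl T z u) ∧
        ∀ u, IsOptimalControl T z u → ∃ v, HasInitialValue u v) ∧
      ∀ v ∈ optimalFeedback T z, ∃ q : ℝ × ℝ × ℝ, z = Z T q ∧ v = U T q) ∧
    ∀ q : ℝ × ℝ × ℝ, Z T q ∈ controllableSet T := by
  have key : ∀ z u, IsOptimalControl T z u →
      ∃ q : ℝ × ℝ × ℝ, z = Z T q ∧ HasInitialValue u (U T q) := by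
    intro z u hu
    obtain ⟨θ₀, hθ₀⟩ := exists_lift_eq z.2.2
    obtain ⟨q, hq⟩ := hu.exists_ae_eq hT hθ₀
    exact ⟨q, exists_eq_Z_of_ae_eq hT hu.1 hθ₀ hq⟩
  refine ⟨fun z hz ↦ ⟨⟨exists_isOptimalControl hT hz, fun u hu ↦ ?_⟩, ?_⟩,
    fun q ↦ Z_mem_controllableSet T q⟩
  · obtain ⟨q, -, hv⟩ := key z u hu
    exact ⟨_, hv⟩
  · rintro v ⟨u, hu, hv⟩
    obtain ⟨q, hz, hq⟩ := key z u hu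
    have := neBot_nhdsGT_inf_ae
    exact ⟨q, hz, tendsto_nhds_unique hv hq⟩
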